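/- **Setting.** Fix integers $d_s,d_u\ge 1$ and put $d=d_s+d_u$. A cone in $\mathbb R^d$ is a set invariant under multiplication by real scalars; for cones $A,B$ write $A\Subset B$ if $\overline A\subset \mathrm{Int}(B)\cup\{0\}$; the dimension of a cone is the maximal dimension of a linear subspace contained in it. A *cone system* is a quadruple $\Theta=(\mathbf C_+,\mathbf C_-,\Phi_+,\Phi_-)$, where $\mathbf C_+,\mathbf C_-\subset\mathbb R^d$ are closed cones with non-empty interiors, of dimensions $d_s$ and $d_u$, with $\mathbf C_+\cap\mathbf C_-=\{0\}$; $\Phi_+:\mathbb S^{d-1}\to[0,1]$ is $\mathcal C^\infty$, equal to $1$ on $\mathbb S^{d-1}\cap\mathbf C_+$ and to $0$ on $\mathbb S^{d-1}\cap\mathbf C_-$; and $\Phi_-=1-\Phi_+$. We write $\Theta<\Theta'$ if $\mathbb R^d\setminus\mathbf C_+'\Subset\mathbf C_-$. Fix an even $\mathcal C^\infty$ function $\chi:\mathbb R\to[0,1]$ with $\chi=1$ for $|x|\le 1$ and $\chi=0$ for $|x|\ge2$. For $\sigma\in\{+,-\}$ let $\psi_{\Theta,0,\sigma}(\xi)=\chi(\|\xi\|)/2$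 and $\psi_{\Theta,n,\sigma}(\xi)=\Phi_\sigma(\xi/\|\xi\|)\,\bigl(\chi(2^{-n}\|\xi\|)-\chi(2^{-n+1}\|\xi\|)\bigr)$ for $n\ge1$, and put $f_{\Theta,n,\sigma}=(\mathcal F^{-1}\psi_{\Theta,n,\sigma})*f$, where $\mathcal F^{-1}\psi(x)=(2\pi)^{-d}\int e^{ix\xi}\psi(\xi)\,d\xi$. Let $\mathcal F(\Theta)$ be the set of $d_u$-dimensional $\mathcal C^1$ submanifolds $\Gamma\subset\mathbb R^d$ such that the line through any two distinct points of $\Gamma$ is normal to a $d_s$-dimensional subspace contained in $\mathbf C_+$, let $\|f\|_{L_1(\mathcal F(\Theta))}=\sup_{\Gamma\in\mathcal F(\Theta)}\int_\Gamma|f|\,d\mu_\Gamma$ with $\mu_\Gamma$ the Riemannian volume on $\Gamma$, and for real $t,s$ let $$\|f\|_{B^{\Theta,t,s}}=\max\Bigl\{\sup_{n\ge0}2^{tn}\|f_{\Theta,n,+}\|_{L_1(\mathcal F(\Theta))},\ \sup_{n\ge0}2^{sn}\|f_{\Theta,n,-}\|_{L_1(\mathcal F(\Theta))}\Bigr\}.$$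 Let $M$ be a $d$-dimensional $\mathcal C^\infty$ manifold without boundary, $V\subset M$ open, $\{\kappa_i:V_i\to\mathbb R^d\}_{i\in I}$ a finite family of $\mathcal C^\infty$ charts of $M$ with $V\subset\bigcup_iV_i$, and $\theta_i:M\to[0,1]$ $(i\in I)$ $\mathcal C^\infty$ functions with compact support contained in $V_i$ and $\sum_i\theta_i=1$ on $V$. Let $\mathcal C^\infty(\overline V)$ be the space of $\mathcal C^\infty$ functions $M\to\mathbb C$ vanishing outside $\overline V$. For a family $\Theta=\{\Theta_i\}_{i\in I}$ of cone systems and real $t,s$, let $B^{\Theta,t,s}$ be the completion of $\mathcal C^\infty(\overline V)$ for the norm $$\|\varphi\|_{B^{\Theta,t,s}}=\max_{i\in I}\bigl\|(\theta_i\varphi)\circ\kappa_i^{-1}\bigr\|_{B^{\Theta_i,t,s}},$$ where $(\theta_i\varphi)\circ\kappa_i^{-1}$ is extended by zero to $\mathbb R^d$. **Theorem (compact embedding of $B^{t,s}$).** Let $s,s'<0<t,t'$ with $t'>t$ and $s'>s$, and let $\Theta=\{\Theta_i\}_{i\in I}$, $\Theta'=\{\Theta'_i\}_{i\in I}$ be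 two families of cone systems with $\Theta_i<\Theta'_i$ for all $i\in I$. Then the norms $\|\cdot\|_{B^{\Theta',t',s'}}$ and $\|\cdot\|_{B^{\Theta,t,s}}$ are finite on $\mathcal C^\infty(\overline V)$, and $B^{\Theta',t',s'}$ embeds compactly into $B^{\Theta,t,s}$: the identity of $\mathcal C^\infty(\overline V)$ extends to an injective compact linear operator $B^{\Theta',t',s'}\to B^{\Theta,t,s}$. -/

import Mathlib

open MeasureTheory Set
open scoped Manifold ContDiff RealInnerProductSpace

noncomputable section

namespace Aniso

/-- Euclidean space `ℝ^d`. -/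
abbrev Eu (d : ℕ) : Type := EuclideanSpace ℝ (Fin d)

/-! ### Cones and cone systems -/

/-- A cone is a set that is invariant under multiplication by real scalars. -/
def IsCone {d : ℕ} (C : Set (Eu d)) : Prop :=
  ∀ (c : ℝ), ∀ x ∈ C, c • x ∈ C

/-- `C` is `k`-dimensional: `k ≥ 1` is the maximal dimension of a linear subspace contained
in `C`. -/
def HasConeDim {d : ℕ} (C : Set (Eu d)) (k : ℕ) : Prop :=
  1 ≤ k ∧ IsGreatest
    {m : ℕ | ∃ W : Submodule ℝ (Eu d), Module.finrank ℝ W = m ∧ (W : Set (Eu d)) ⊆ C} k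

/-- The relation `A ⋐ B` for cones: the closure of `A` lies in the interior of `B`, up to the
origin. -/
def ConeSubset {d : ℕ} (A B : Set (Eu d)) : Prop :=
  closure A ⊆ interior B ∪ {0}

/-- The index set `{+, -}`. -/
inductive Sgn : Type
  | plus : Sgn
  | minus : Sgn

/-- A cone system `(C₊, C₋, Φ₊, Φ₋)` in `ℝ^d`, with `C₊` of dimension `ds` and `C₋` of
dimension `du`, where `ds + du = d`.  Only the values of `PhiPlus` on the unit sphere are ever
used; a function on the unit sphere is smooth iff its extension to `ℝ^d ∖ {0}` that is constant
on rays is smooth.  The function `Φ₋ = 1 - Φ₊` is derived. -/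
structure ConeSystem (d ds du : ℕ) where
  Cplus : Set (Eu d)
  Cminus : Set (Eu d)
  PhiPlus : Eu d → ℝ
  dim_add : ds + du = d
  cone_plus : IsCone Cplus
  cone_minus : IsCone Cminus
  closed_plus : IsClosed Cplus
  closed_minus : IsClosed Cminus
  interior_plus : (interior Cplus).Nonempty
  interior_minus : (interior Cminus).Nonempty
  dim_plus : HasConeDim Cplus ds
  dim_minus : HasConeDim Cminus du
  transversal : Cplus ∩ Cminus = {0}
  smooth : ContDiffOn ℝ ∞ (fun ξ : Eu d => PhiPlus (‖ξ‖⁻¹ • ξ)) {0}ᶜ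
  mem_Icc : ∀ ξ ∈ Metric.sphere (0 : Eu d) 1, PhiPlus ξ ∈ Icc (0 : ℝ) 1
  eq_one : ∀ ξ ∈ Metric.sphere (0 : Eu d) 1 ∩ Cplus, PhiPlus ξ = 1
  eq_zero : ∀ ξ ∈ Metric.sphere (0 : Eu d) 1 ∩ Cminus, PhiPlus ξ = 0

/-- `Φ₊` and `Φ₋ = 1 - Φ₊`. -/
def ConeSystem.Phi {d ds du : ℕ} (Θ : ConeSystem d ds du) : Sgn → Eu d → ℝ
  | .plus, ξ => Θ.PhiPlus ξ
  | .minus, ξ => 1 - Θ.PhiPlus ξ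

/-- The relation `Θ < Θ'`: `ℝ^d ∖ C'₊ ⋐ C₋`. -/
def ConeSystem.Below {d ds du : ℕ} (Θ Θ' : ConeSystem d ds du) : Prop :=
  ConeSubset (Θ'.Cplus)ᶜ Θ.Cminus

/-! ### The anisotropic Littlewood--Paley decomposition -/

/-- An even smooth bump function `χ : ℝ → [0,1]`, equal to `1` for `|x| ≤ 1` and to `0` for
`|x| ≥ 2`. -/
structure Cutoff where
  toFun : ℝ → ℝ
  smooth : ContDiff ℝ ∞ toFun
  even : ∀ x, toFun (-x) = toFun x
  mem_Icc : ∀ x, toFun x ∈ Icc (0 : ℝ) 1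
  eq_one : ∀ x, |x| ≤ 1 → toFun x = 1
  eq_zero : ∀ x, 2 ≤ |x| → toFun x = 0

/-- The isotropic dyadic functions `ψ_n`: `ψ_0(ξ) = χ(‖ξ‖)` and
`ψ_n(ξ) = χ(2^{-n}‖ξ‖) - χ(2^{-n+1}‖ξ‖)` for `n ≥ 1`. -/
def dyadic {d : ℕ} (χ : Cutoff) : ℕ → Eu d → ℝ
  | 0, ξ => χ.toFun ‖ξ‖
  | n + 1, ξ => χ.toFun (((2 : ℝ) ^ (n + 1))⁻¹ * ‖ξ‖) - χ.toFun (((2 : ℝ) ^ n)⁻¹ * ‖ξ‖)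

/-- The anisotropic functions `ψ_{Θ,n,σ}`: `χ(‖ξ‖)/2` for `n = 0`, and `Φ_σ(ξ/‖ξ‖) ψ_n(ξ)` for
`n ≥ 1`. -/
def psi {d ds du : ℕ} (χ : Cutoff) (Θ : ConeSystem d ds du) : ℕ → Sgn → Eu d → ℝ
  | 0, _, ξ => χ.toFun ‖ξ‖ / 2
  | n + 1, σ, ξ => Θ.Phi σ (‖ξ‖⁻¹ • ξ) * dyadic χ (n + 1) ξ

/-- The inverse Fourier transform `(2π)^{-d} ∫ e^{i x ξ} ψ(ξ) dξ`. -/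
def invFourier {d : ℕ} (ψ : Eu d → ℝ) (x : Eu d) : ℂ :=
  (((2 * Real.pi) ^ d : ℝ) : ℂ)⁻¹ *
    ∫ ξ : Eu d, Complex.exp (Complex.I * ((⟪x, ξ⟫ : ℝ) : ℂ)) * ((ψ ξ : ℝ) : ℂ)

/-- The component `φ_{Θ,n,σ}` of a function: its convolution with the inverse Fourier
transform of `ψ_{Θ,n,σ}`. -/
def component {d ds du : ℕ} (χ : Cutoff) (Θ : ConeSystem d ds du) (n : ℕ) (σ : Sgn)
    (f : Eu d → ℂ) (x : Eu d) : ℂ :=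
  ∫ y : Eu d, invFourier (psi χ Θ n σ) (x - y) * f y

/-! ### Fake unstable leaves and the local anisotropic norm -/

/-- `Γ` is a (not necessarily closed, embedded) `C¹` submanifold of `ℝ^d` of dimension `k`:
locally, a `C¹` change of coordinates of `ℝ^d` takes `Γ` to a `k`-dimensional subspace. -/
def IsC1Submanifold {d : ℕ} (k : ℕ) (Γ : Set (Eu d)) : Prop :=
  ∀ x ∈ Γ, ∃ (e : OpenPartialHomeomorph (Eu d) (Eu d)) (W : Submodule ℝ (Eu d)),
    x ∈ e.source ∧ ContDiffOn ℝ 1 e e.source ∧ ContDiffOn ℝ 1 e.symm e.target ∧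
      Module.finrank ℝ W = k ∧ e '' (e.source ∩ Γ) = e.target ∩ (W : Set (Eu d))

/-- The set `F(Θ)` of fake unstable leaves: the `C¹` submanifolds of dimension `du` such that
the line through any two of its points is normal to a `ds`-dimensional subspace contained
in `C₊`. -/
def ConeSystem.leaves {d ds du : ℕ} (Θ : ConeSystem d ds du) : Set (Set (Eu d)) :=
  {Γ | IsC1Submanifold du Γ ∧ ∀ x ∈ Γ, ∀ y ∈ Γ, x ≠ y →
    ∃ W : Submodule ℝ (Eu d), Module.finrank ℝ W = ds ∧ (W : Set (Eu d)) ⊆ Θ.Cplus ∧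
      ∀ w ∈ W, ⟪y - x, w⟫ = 0}

/-- The norm `‖f‖_{L₁(F(Θ))}`, the supremum over the leaves of the integral of `|f|` against the
Riemannian volume, which on a `C¹` submanifold of dimension `du` is the (normalised)
`du`-dimensional Hausdorff measure. -/
def leafNorm {d ds du : ℕ} (Θ : ConeSystem d ds du) (f : Eu d → ℂ) : ENNReal :=
  ⨆ Γ ∈ Θ.leaves, ∫⁻ x in Γ, ‖f x‖ₑ ∂(Measure.euclideanHausdorffMeasure du)

/-- The weighted supremum `sup_n 2^{rn} ‖φ_{Θ,n,σ}‖_{L₁(F)}`. -/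
def signedNorm {d ds du : ℕ} (χ : Cutoff) (Θ : ConeSystem d ds du) (r : ℝ) (σ : Sgn)
    (f : Eu d → ℂ) : ENNReal :=
  ⨆ n : ℕ, ENNReal.ofReal ((2 : ℝ) ^ (r * (n : ℝ))) * leafNorm Θ (component χ Θ n σ f)

/-- The local anisotropic norm `‖f‖_{B^{Θ,t,s}}`, with values in `[0,∞]`. -/
def localNorm {d ds du : ℕ} (χ : Cutoff) (Θ : ConeSystem d ds du) (t s : ℝ)
    (f : Eu d → ℂ) : ENNReal :=
  max (signedNorm χ Θ t .plus f) (signedNorm χ Θ s .minus f)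

/-! ### Charts and the anisotropic norm on a manifold -/

/-- A finite family of smooth charts `κ_i : V_i → ℝ^d` of `M` covering `V`, with a smooth
partition of unity `θ_i : M → [0,1]` for `V`, where `θ_i` has compact support contained
in `V_i`. -/
structure ChartSystem {d : ℕ} {M : Type*} [TopologicalSpace M] [ChartedSpace (Eu d) M]
    (V : Set M) (I : Type*) [Fintype I] where
  chart : I → OpenPartialHomeomorph M (Eu d)
  chart_mem : ∀ i, chart i ∈ IsManifold.maximalAtlas (𝓡 d) ∞ M
  cover : V ⊆ ⋃ i, (chart i).source
  θ : I → M → ℝ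
  θ_smooth : ∀ i, ContMDiff (𝓡 d) 𝓘(ℝ, ℝ) ∞ (θ i)
  θ_mem_Icc : ∀ i x, θ i x ∈ Icc (0 : ℝ) 1
  θ_compact : ∀ i, HasCompactSupport (θ i)
  θ_support : ∀ i, tsupport (θ i) ⊆ (chart i).source
  θ_sum : ∀ x ∈ V, ∑ i, θ i x = 1

section Space

variable {d ds du : ℕ} {M : Type*} [TopologicalSpace M] [ChartedSpace (Eu d) M]
  {V : Set M} {I : Type*} [Fintype I]

/-- The function `(θ_i φ) ∘ κ_i⁻¹` on `ℝ^d`, extended by zero outside `κ_i(V_i)`. -/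
def ChartSystem.push (D : ChartSystem (d := d) V I) (i : I) (φ : M → ℂ) : Eu d → ℂ :=
  (D.chart i).target.indicator
    (fun x => ((D.θ i ((D.chart i).symm x) : ℝ) : ℂ) * φ ((D.chart i).symm x))

/-- The norm `max_i ‖(θ_i φ) ∘ κ_i⁻¹‖_{B^{Θ_i,t,s}}`, with values in `[0,∞]`. -/
def ChartSystem.normB (D : ChartSystem (d := d) V I) (χ : Cutoff)
    (Θ : I → ConeSystem d ds du) (t s : ℝ) (φ : M → ℂ) : ENNReal :=
  ⨆ i, localNorm χ (Θ i) t s (D.push i φ)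

/-- The smooth functions `M → ℂ` supported in the closure of `V`. -/
def SmoothOn (d : ℕ) {M : Type*} [TopologicalSpace M] [ChartedSpace (Eu d) M] (V : Set M) :
    Submodule ℂ (M → ℂ) where
  carrier := {φ | ContMDiff (𝓡 d) 𝓘(ℝ, ℂ) ∞ φ ∧ Function.support φ ⊆ closure V}
  add_mem' := by
    rintro φ ψ ⟨h1, h2⟩ ⟨h3, h4⟩
    exact ⟨h1.add h3, (Function.support_add φ ψ).trans (union_subset h2 h4)⟩
  zero_mem' := by
    refine ⟨contMDiff_const, ?_⟩
    simp
  smul_mem' := by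
    rintro c φ ⟨h1, h2⟩
    refine ⟨?_, (Function.support_const_smul_subset c φ).trans h2⟩
    have hc : ContDiff ℝ ∞ (fun z : ℂ => c • z) := contDiff_id.const_smul c
    exact hc.contMDiff.comp h1

/-! ### Subadditivity and homogeneity of the norms -/

lemma continuous_invFourier (ψ : Eu d → ℝ) :
    Continuous (invFourier ψ) := by
  have hu (x ξ : Eu d) : ‖Complex.exp (Complex.I * ((⟪x, ξ⟫ : ℝ) : ℂ))‖ = 1 := by
    rw [mul_comm]; exact Complex.norm_exp_ofReal_mul_I _
  have hc (x : Eu d) : Continuous fun ξ : Eu d =>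
      Complex.exp (Complex.I * ((⟪x, ξ⟫ : ℝ) : ℂ)) := by fun_prop
  by_cases h : Integrable (fun ξ : Eu d => ((ψ ξ : ℝ) : ℂ))
  · refine continuous_const.mul ?_
    refine continuous_of_dominated (bound := fun ξ => ‖((ψ ξ : ℝ) : ℂ)‖) ?_ ?_ h.norm ?_
    · intro x
      exact (hc x).aestronglyMeasurable.mul h.aestronglyMeasurable
    · intro x
      refine Filter.Eventually.of_forall fun ξ => ?_
      rw [norm_mul, hu, one_mul]
    · refine Filter.Eventually.of_forall fun ξ => ?_
      fun_prop
  · have h0 : invFourier ψ = fun _ => 0 := by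
      funext x
      unfold invFourier
      rw [integral_undef, mul_zero]
      intro hi
      apply h
      have h2 := hi.bdd_mul (c := 1) (f := fun ξ : Eu d =>
        Complex.exp (Complex.I * ((⟪-x, ξ⟫ : ℝ) : ℂ))) (hc (-x)).aestronglyMeasurable
        (Filter.Eventually.of_forall fun ξ => (hu (-x) ξ).le)
      refine h2.congr (Filter.Eventually.of_forall fun ξ => ?_)
      simp only [← mul_assoc, ← Complex.exp_add, inner_neg_left]
      simp
    rw [h0]
    exact continuous_const

lemma ChartSystem.push_continuous (D : ChartSystem (d := d) V I) (i : I) {φ : M → ℂ}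
    (hφ : Continuous φ) : Continuous (D.push i φ) ∧ HasCompactSupport (D.push i φ) := by
  have hK : IsCompact ((D.chart i) '' tsupport (D.θ i)) :=
    (D.θ_compact i).image_of_continuousOn
      ((D.chart i).continuousOn.mono (D.θ_support i))
  have hz : ∀ x, x ∉ (D.chart i) '' tsupport (D.θ i) → D.push i φ x = 0 := by
    intro x hx
    by_cases hxt : x ∈ (D.chart i).target
    · rw [ChartSystem.push, indicator_of_mem hxt]
      have : (D.chart i).symm x ∉ tsupport (D.θ i) := fun h =>
        hx ⟨_, h, (D.chart i).right_inv hxt⟩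
      rw [image_eq_zero_of_notMem_tsupport this]
      simp
    · exact indicator_of_notMem hxt _
  refine ⟨continuous_iff_continuousAt.2 fun x => ?_, HasCompactSupport.intro hK hz⟩
  by_cases hx : x ∈ (D.chart i) '' tsupport (D.θ i)
  · have hxt : x ∈ (D.chart i).target := by
      obtain ⟨y, hy, rfl⟩ := hx
      exact (D.chart i).map_source (D.θ_support i hy)
    have hn : (D.chart i).target ∈ nhds x := (D.chart i).open_target.mem_nhds hxt
    have hg : Continuous fun m => ((D.θ i m : ℝ) : ℂ) * φ m :=
      (Complex.continuous_ofReal.comp (D.θ_smooth i).continuous).mul hφ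
    have h1 : ContinuousAt (fun y => ((D.θ i ((D.chart i).symm y) : ℝ) : ℂ) *
        φ ((D.chart i).symm y)) x :=
      ContinuousAt.comp (f := (D.chart i).symm) hg.continuousAt
        ((D.chart i).symm.continuousAt hxt)
    refine h1.congr ?_
    filter_upwards [hn] with y hy
    rw [ChartSystem.push, indicator_of_mem hy]
  · have hn := hK.isClosed.isOpen_compl.mem_nhds hx
    refine (continuousAt_const (y := (0 : ℂ))).congr ?_
    filter_upwards [hn] with y hy
    exact (hz y hy).symm

lemma component_integrable (χ : Cutoff) (Θ : ConeSystem d ds du) (n : ℕ) (σ : Sgn)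
    {f : Eu d → ℂ} (hf : Continuous f) (hc : HasCompactSupport f) (x : Eu d) :
    Integrable (fun y => invFourier (psi χ Θ n σ) (x - y) * f y) := by
  refine Continuous.integrable_of_hasCompactSupport ?_ hc.mul_left
  exact ((continuous_invFourier _).comp (continuous_const.sub continuous_id)).mul hf

lemma component_continuous (χ : Cutoff) (Θ : ConeSystem d ds du) (n : ℕ) (σ : Sgn)
    {f : Eu d → ℂ} (hf : Continuous f) (hc : HasCompactSupport f) :
    Continuous (component χ Θ n σ f) := by
  have h := hc.continuous_convolution_left (ContinuousLinearMap.mul ℂ ℂ) (μ := volume)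
    hf (continuous_invFourier (psi χ Θ n σ)).locallyIntegrable
  refine h.congr fun x => ?_
  simp only [convolution, component, ContinuousLinearMap.mul_apply']
  exact integral_congr_ae (Filter.Eventually.of_forall fun y => mul_comm _ _)

lemma localNorm_add_le (χ : Cutoff) (Θ : ConeSystem d ds du) (t s : ℝ) {f g : Eu d → ℂ}
    (hf : Continuous f) (hfc : HasCompactSupport f) (hg : Continuous g)
    (hgc : HasCompactSupport g) :
    localNorm χ Θ t s (f + g) ≤ localNorm χ Θ t s f + localNorm χ Θ t s g := by
  have key (r : ℝ) (σ : Sgn) :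
      signedNorm χ Θ r σ (f + g) ≤ signedNorm χ Θ r σ f + signedNorm χ Θ r σ g := by
    refine iSup_le fun n => ?_
    refine le_trans ?_ (add_le_add
      (le_iSup (fun n : ℕ => ENNReal.ofReal ((2 : ℝ) ^ (r * (n : ℝ))) *
        leafNorm Θ (component χ Θ n σ f)) n)
      (le_iSup (fun n : ℕ => ENNReal.ofReal ((2 : ℝ) ^ (r * (n : ℝ))) *
        leafNorm Θ (component χ Θ n σ g)) n))
    rw [← mul_add]
    gcongr
    refine iSup₂_le fun Γ hΓ => ?_
    refine le_trans ?_ (add_le_add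
      (le_iSup₂ (f := fun (Γ : Set (Eu d)) (_ : Γ ∈ Θ.leaves) =>
        ∫⁻ x in Γ, ‖component χ Θ n σ f x‖ₑ ∂(Measure.euclideanHausdorffMeasure du)) Γ hΓ)
      (le_iSup₂ (f := fun (Γ : Set (Eu d)) (_ : Γ ∈ Θ.leaves) =>
        ∫⁻ x in Γ, ‖component χ Θ n σ g x‖ₑ ∂(Measure.euclideanHausdorffMeasure du)) Γ hΓ))
    rw [← lintegral_add_left (component_continuous χ Θ n σ hf hfc).enorm.measurable]
    refine lintegral_mono fun x => ?_
    have : component χ Θ n σ (f + g) x = component χ Θ n σ f x + component χ Θ n σ g x := by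
      unfold component
      rw [← integral_add (component_integrable χ Θ n σ hf hfc x)
        (component_integrable χ Θ n σ hg hgc x)]
      simp only [Pi.add_apply, mul_add]
    rw [this]
    exact enorm_add_le _ _
  exact max_le
    ((key t .plus).trans (add_le_add (le_max_left _ _) (le_max_left _ _)))
    ((key s .minus).trans (add_le_add (le_max_right _ _) (le_max_right _ _)))

lemma localNorm_smul (χ : Cutoff) (Θ : ConeSystem d ds du) (t s : ℝ) (c : ℂ)
    (f : Eu d → ℂ) : localNorm χ Θ t s (c • f) = ‖c‖ₑ * localNorm χ Θ t s f := by
  have key (r : ℝ) (σ : Sgn) :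
      signedNorm χ Θ r σ (c • f) = ‖c‖ₑ * signedNorm χ Θ r σ f := by
    unfold signedNorm
    rw [ENNReal.mul_iSup]
    refine iSup_congr fun n => ?_
    rw [mul_left_comm]
    congr 1
    unfold leafNorm
    simp only [ENNReal.mul_iSup]
    refine iSup_congr fun Γ => iSup_congr fun _ => ?_
    rw [← lintegral_const_mul' _ _ enorm_ne_top]
    refine lintegral_congr fun x => ?_
    rw [← enorm_mul]
    congr 1
    unfold component
    rw [← integral_const_mul]
    congr 1
    funext y
    simp only [Pi.smul_apply, smul_eq_mul]
    ring
  unfold localNorm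
  rw [key, key, mul_max]

lemma normB_add_le (D : ChartSystem (d := d) V I) (χ : Cutoff)
    (Θ : I → ConeSystem d ds du) (t s : ℝ) {φ ψ : M → ℂ} (hφ : Continuous φ)
    (hψ : Continuous ψ) :
    D.normB χ Θ t s (φ + ψ) ≤ D.normB χ Θ t s φ + D.normB χ Θ t s ψ := by
  refine iSup_le fun i => ?_
  have h1 : D.push i (φ + ψ) = D.push i φ + D.push i ψ := by
    unfold ChartSystem.push
    rw [← indicator_add']
    congr 1
    funext x
    simp only [Pi.add_apply, mul_add]
  rw [h1]
  obtain ⟨a, b⟩ := D.push_continuous i hφ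
  obtain ⟨a', b'⟩ := D.push_continuous i hψ
  exact (localNorm_add_le χ (Θ i) t s a b a' b').trans (add_le_add
    (le_iSup (fun i => localNorm χ (Θ i) t s (D.push i φ)) i)
    (le_iSup (fun i => localNorm χ (Θ i) t s (D.push i ψ)) i))

lemma normB_smul (D : ChartSystem (d := d) V I) (χ : Cutoff)
    (Θ : I → ConeSystem d ds du) (t s : ℝ) (c : ℂ) (φ : M → ℂ) :
    D.normB χ Θ t s (c • φ) = ‖c‖ₑ * D.normB χ Θ t s φ := by
  unfold ChartSystem.normB
  rw [ENNReal.mul_iSup]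
  refine iSup_congr fun i => ?_
  rw [← localNorm_smul]
  congr 1
  funext x
  by_cases hx : x ∈ (D.chart i).target
  · simp only [ChartSystem.push, Pi.smul_apply, indicator_of_mem hx, smul_eq_mul]
    ring
  · simp only [ChartSystem.push, Pi.smul_apply, indicator_of_notMem hx, smul_zero]

/-- The functions in `C^∞(V̄)` whose anisotropic norm is finite. -/
def ChartSystem.finite (D : ChartSystem (d := d) V I) (χ : Cutoff)
    (Θ : I → ConeSystem d ds du) (t s : ℝ) : Submodule ℂ (M → ℂ) where
  carrier := {φ | φ ∈ SmoothOn d V ∧ D.normB χ Θ t s φ < ⊤}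
  add_mem' := by
    rintro φ ψ ⟨h1, h2⟩ ⟨h3, h4⟩
    exact ⟨Submodule.add_mem _ h1 h3,
      (normB_add_le D χ Θ t s h1.1.continuous h3.1.continuous).trans_lt
        (ENNReal.add_lt_top.2 ⟨h2, h4⟩)⟩
  zero_mem' := by
    refine ⟨Submodule.zero_mem _, ?_⟩
    have := normB_smul D χ Θ t s 0 (0 : M → ℂ)
    simp only [smul_zero, _root_.enorm_zero, zero_mul] at this
    simp [this]
  smul_mem' := by
    rintro c φ ⟨h1, h2⟩
    refine ⟨Submodule.smul_mem _ c h1, ?_⟩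
    rw [normB_smul]
    exact ENNReal.mul_lt_top enorm_lt_top h2

/-- The space `C^∞(V̄)` equipped with the anisotropic norm (restricted to the functions for which
it is finite). -/
def PreB (D : ChartSystem (d := d) V I) (χ : Cutoff) (Θ : I → ConeSystem d ds du)
    (t s : ℝ) : Type _ :=
  D.finite χ Θ t s

variable (D : ChartSystem (d := d) V I) (χ : Cutoff) (Θ : I → ConeSystem d ds du) (t s : ℝ)

instance : AddCommGroup (PreB D χ Θ t s) :=
  inferInstanceAs (AddCommGroup (D.finite χ Θ t s))

instance : Module ℂ (PreB D χ Θ t s) :=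
  inferInstanceAs (Module ℂ (D.finite χ Θ t s))

/-- The anisotropic norm, as a real-valued seminorm. -/
def preSeminorm : Seminorm ℂ (PreB D χ Θ t s) :=
  Seminorm.of (fun φ => (D.normB χ Θ t s φ.1).toReal)
    (fun φ ψ => by
      have h := normB_add_le D χ Θ t s φ.2.1.1.continuous ψ.2.1.1.continuous
      have h' := ENNReal.toReal_mono (ENNReal.add_lt_top.2 ⟨φ.2.2, ψ.2.2⟩).ne h
      rw [ENNReal.toReal_add φ.2.2.ne ψ.2.2.ne] at h'
      exact h')
    (fun c φ => by
      have h := congrArg ENNReal.toReal (normB_smul D χ Θ t s c φ.1)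
      rw [ENNReal.toReal_mul, toReal_enorm] at h
      exact h)

instance : SeminormedAddCommGroup (PreB D χ Θ t s) :=
  (preSeminorm D χ Θ t s).toAddGroupSeminorm.toSeminormedAddCommGroup

instance : NormedSpace ℂ (PreB D χ Θ t s) where
  norm_smul_le c φ := ((preSeminorm D χ Θ t s).smul' c φ).le

/-- The anisotropic Banach space `B^{Θ,t,s}`: the completion of `C^∞(V̄)` for the norm
`max_i ‖(θ_i φ) ∘ κ_i⁻¹‖_{B^{Θ_i,t,s}}`. -/
abbrev BSpace : Type _ := UniformSpace.Completion (PreB D χ Θ t s)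

/-- The canonical element of `B^{Θ,t,s}` given by a function in `C^∞(V̄)`. -/
def toB (φ : M → ℂ) (hφ : φ ∈ D.finite χ Θ t s) : BSpace D χ Θ t s :=
  UniformSpace.Completion.coe' (α := PreB D χ Θ t s) ⟨φ, hφ⟩

end Space

end Aniso

end

/-!
The embedding is compact because of a comparison that loses only finitely many functionals: for
`Θ < Θ'`, `t < t'`, `s < s'`, a radius `R` and every `ε > 0` there are finitely many linear
functionals `ℓ_j` with `‖f‖_{B^{Θ,t,s}} ≤ ε ‖f‖_{B^{Θ',t',s'}} + ∑_j |ℓ_j(f)|` for all smooth `f`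
supported in the ball of radius `R`, and the `ℓ_j` are continuous for the norm of `B^{Θ',t',s'}`
(`exists_localNorm_le_finset`, transported to the manifold in `PreB.exists_functionals`).

*High frequencies.* `Θ < Θ'` implies `C₊ ⊆ C'₊`, so every leaf for `Θ` is a leaf for `Θ'`, and
`Φ'₊ = 1` on the support of `Φ₊`. Hence `f_{Θ,n,+}` is the convolution of a kernel with three
consecutive components `f_{Θ',m,+}`, `|m - n| ≤ 1`, while `f_{Θ,n,-}` involves components of both
signs. The kernels have bounded integral, and the family of leaves is invariant under translations,
so that convolution is bounded for the leaf norm (`ConeSystem.leafNorm_convS_le`). This gives the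
gains `2^{-(t'-t)n}` and, as `s' ≤ t'`, `2^{-(s'-s)n}`, which are at most `ε` for large `n`.

*Low frequencies.* Each of the remaining components is the convolution of `f` with a fixed Schwartz
function `k`. The norm of `B^{Θ',t',s'}` bounds `k * f` and its derivatives pointwise, with rapid
decay (`exists_norm_convS_le_of_localNorm_le`). To see this, sum the pairings of a test function `g`
with all components: for `n ≥ 1` the `n`-th component is `Δ^N` of `2^{-2Nn}` times a smoothed
component, so after moving `Δ^N` to `g` the pairing decays geometrically. The pairing itself is
controlled by the leaf norm because parallel affine leaves foliate the space
(`ConeSystem.exists_lintegral_mul_le`). Conversely, leaves are graphs of uniformly Lipschitz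
functions over a fixed `du`-dimensional subspace of `C₋`, so functions that decay fast enough have
finite leaf norm (`ConeSystem.exists_leafNorm_le_of_decay`). Equicontinuity and decay then reduce
the leaf norm of `k * f` to the values of `k * f` at finitely many points, up to `ε`
(`exists_leafNorm_convS_le_finset`).

Finiteness of the norms on smooth functions uses the same two facts, moving the powers of the
Laplacian to `f` (`localNorm_lt_top`). Injectivity of the extension to the completions holds because
the stronger norm is a supremum of seminorms, the leaf norms of the single components, each of
which is bounded by the weaker norm; a Cauchy sequence for the stronger norm that tends to zero
for the weaker one therefore tends to zero for the stronger one (`injective_completion`).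
-/

open FourierTransform Laplacian LineDeriv
open scoped SchwartzMap ENNReal NNReal

noncomputable section

namespace Aniso

/-! ### Fourier multipliers and convolution on Schwartz functions -/

section Schwartz

variable {d : ℕ}

/-- Complex-valued Schwartz functions on `ℝ^d`. -/
abbrev Sch (d : ℕ) : Type := 𝓢(Eu d, ℂ)

/-- Pointwise product of Schwartz functions. -/
def mulS (f g : Sch d) : Sch d := SchwartzMap.pairing (ContinuousLinearMap.mul ℂ ℂ) f g

@[simp] lemma mulS_apply (f g : Sch d) (x : Eu d) : mulS f g x = f x * g x := by
  simp [mulS]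

/-- Convolution of Schwartz functions. -/
def convS (k f : Sch d) : Sch d := SchwartzMap.convolution (ContinuousLinearMap.mul ℂ ℂ) k f

lemma convS_apply (k f : Sch d) (x : Eu d) : convS k f x = ∫ y, k (x - y) * f y := by
  rw [convS, SchwartzMap.convolution_apply]
  exact convolution_mul_swap

lemma fourier_convS (k f : Sch d) (ξ : Eu d) : 𝓕 (convS k f) ξ = 𝓕 k ξ * 𝓕 f ξ := by
  rw [convS, SchwartzMap.fourier_convolution]
  simp

lemma eq_of_fourier_eq {f g : Sch d} (h : ∀ ξ, 𝓕 f ξ = 𝓕 g ξ) : f = g := by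
  have : 𝓕 f = 𝓕 g := SchwartzMap.ext h
  rw [← FourierTransform.fourierInv_fourier_eq (E := Sch d) (F := Sch d) f, this,
    FourierTransform.fourierInv_fourier_eq]

/-- Dilation `a ↦ a (c •)` of a Schwartz function. -/
def dilate (c : ℝˣ) (a : Sch d) : Sch d :=
  SchwartzMap.compCLMOfContinuousLinearEquiv ℂ (ContinuousLinearEquiv.smulLeft c) a

@[simp] lemma dilate_apply (c : ℝˣ) (a : Sch d) (x : Eu d) : dilate c a x = a ((c : ℝ) • x) := rfl

/-- The unit `2π`, converting the frequency normalisation of `invFourier` into that of `𝓕`. -/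
def twoPi : ℝˣ := Units.mk0 (2 * Real.pi) (by positivity)

@[simp] lemma coe_twoPi : (twoPi : ℝ) = 2 * Real.pi := rfl

/-- The unit `2^{-n}`. -/
def scale (n : ℕ) : ℝˣ := Units.mk0 ((2 : ℝ) ^ n)⁻¹ (by positivity)

@[simp] lemma coe_scale (n : ℕ) : (scale n : ℝ) = ((2 : ℝ) ^ n)⁻¹ := rfl

/-- The convolution kernel with symbol `a`: the inverse Fourier transform
`(2π)^{-d} ∫ e^{i x ξ} a(ξ) dξ` as a Schwartz function. -/
def ker (a : Sch d) : Sch d := 𝓕⁻ (dilate twoPi a)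

@[simp] lemma fourier_ker (a : Sch d) (ξ : Eu d) : 𝓕 (ker a) ξ = a ((2 * Real.pi) • ξ) := by
  rw [ker, FourierTransform.fourier_fourierInv_eq]
  simp

lemma fourierInv_dilate (c : ℝˣ) (a : Sch d) (x : Eu d) :
    𝓕⁻ (dilate c a) x = ((|(c : ℝ) ^ d|⁻¹ : ℝ) : ℂ) * 𝓕⁻ a ((c : ℝ)⁻¹ • x) := by
  have hc : (c : ℝ) ≠ 0 := c.ne_zero
  rw [SchwartzMap.fourierInv_coe, SchwartzMap.fourierInv_coe, Real.fourierInv_eq,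
    Real.fourierInv_eq]
  have := Measure.integral_comp_smul (volume : Measure (Eu d))
    (fun v : Eu d => Real.fourierChar (inner ℝ v ((c : ℝ)⁻¹ • x)) • a v) (c : ℝ)
  rw [finrank_euclideanSpace_fin, abs_inv] at this
  rw [← Complex.real_smul, ← this]
  congr 1
  funext v
  rw [inner_smul_left, inner_smul_right]
  simp [hc]

lemma ker_dilate (c : ℝˣ) (a : Sch d) (x : Eu d) :
    ker (dilate c a) x = ((|(c : ℝ) ^ d|⁻¹ : ℝ) : ℂ) * ker a ((c : ℝ)⁻¹ • x) := by
  have : dilate twoPi (dilate c a) = dilate c (dilate twoPi a) := by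
    ext x; simp [smul_smul, mul_comm]
  rw [ker, this, fourierInv_dilate]
  rfl

lemma ker_eq_integral (a : Sch d) (x : Eu d) :
    ker a x = (((2 * Real.pi) ^ d : ℝ) : ℂ)⁻¹ *
      ∫ ξ : Eu d, Complex.exp (Complex.I * ((⟪x, ξ⟫ : ℝ) : ℂ)) * a ξ := by
  rw [ker, fourierInv_dilate, SchwartzMap.fourierInv_coe, Real.fourierInv_eq]
  have hp : (0 : ℝ) < 2 * Real.pi := by positivity
  congr 1
  · rw [coe_twoPi, abs_of_pos (by positivity), Complex.ofReal_inv]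
  · congr 1
    funext v
    rw [Circle.smul_def, Real.fourierChar_apply, smul_eq_mul]
    congr 2
    rw [inner_smul_right, coe_twoPi, real_inner_comm]
    push_cast
    field_simp

lemma fourier_convS_ker (a f : Sch d) (ξ : Eu d) :
    𝓕 (convS (ker a) f) ξ = a ((2 * Real.pi) • ξ) * 𝓕 f ξ := by
  rw [fourier_convS, fourier_ker]

/-- The power `Δ^N` of the Laplacian on Schwartz functions. -/
def lapPow (N : ℕ) : Sch d →L[ℂ] Sch d := (laplacianCLM ℂ (Eu d) (Sch d)) ^ N

lemma fourier_laplacian (f : Sch d) (ξ : Eu d) :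
    𝓕 (Δ f) ξ = -((‖(2 * Real.pi) • ξ‖ ^ 2 : ℝ) : ℂ) * 𝓕 f ξ := by
  rw [SchwartzMap.laplacian_eq_fourierMultiplierCLM, SchwartzMap.fourierMultiplierCLM_apply,
    FourierTransform.fourier_smul, FourierTransform.fourier_fourierInv_eq, smul_apply,
    SchwartzMap.smulLeftCLM_apply_apply (by fun_prop)]
  rw [norm_smul, Complex.real_smul, Complex.real_smul, Real.norm_eq_abs,
    abs_of_pos (by positivity : (0:ℝ) < 2 * Real.pi)]
  push_cast
  simp
  ring

lemma lapPow_succ (N : ℕ) (f : Sch d) : lapPow (N + 1) f = Δ (lapPow N f) := by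
  rw [lapPow, pow_succ', mul_apply_eq_comp, SchwartzMap.laplacianCLM_eq]
  rfl

lemma lapPow_zero (f : Sch d) : lapPow 0 f = f := by
  simp [lapPow]

lemma fourier_lapPow (N : ℕ) (f : Sch d) (ξ : Eu d) :
    𝓕 (lapPow N f) ξ = (-1) ^ N * ((‖(2 * Real.pi) • ξ‖ ^ (2 * N) : ℝ) : ℂ) * 𝓕 f ξ := by
  induction N with
  | zero => simp [lapPow_zero]
  | succ N ih =>
    rw [lapPow_succ, fourier_laplacian, ih]
    push_cast
    ring

lemma integral_mul_lapPow (N : ℕ) (f g : Sch d) :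
    ∫ x, f x * lapPow N g x = ∫ x, lapPow N f x * g x := by
  induction N generalizing f with
  | zero => simp [lapPow_zero]
  | succ N ih =>
    have h2 : ∀ M (f : Sch d), lapPow M (Δ f) = lapPow (M + 1) f := by
      intro M f
      rw [lapPow, lapPow, pow_succ, mul_apply_eq_comp, SchwartzMap.laplacianCLM_eq]
    rw [lapPow_succ, SchwartzMap.integral_mul_laplacian_right_eq_left, ih, h2]

lemma fderiv_convS (k f : Sch d) (x v : Eu d) :
    fderiv ℝ (convS k f) x v = convS (∂_{v} k) f x := by
  rw [← SchwartzMap.lineDerivOp_apply_eq_fderiv]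
  congr 1
  apply eq_of_fourier_eq
  intro ξ
  rw [fourier_convS, SchwartzMap.fourier_lineDerivOp_eq, SchwartzMap.fourier_lineDerivOp_eq]
  simp only [smul_apply]
  rw [SchwartzMap.smulLeftCLM_apply_apply (by fun_prop),
    SchwartzMap.smulLeftCLM_apply_apply (by fun_prop), fourier_convS]
  simp [mul_assoc]

lemma integral_mul_fourierInv (f g : Sch d) : ∫ x, f x * 𝓕⁻ g x = ∫ x, 𝓕⁻ f x * g x :=
  (SchwartzMap.integral_fourierInv_mul_eq f g).symm

/-- The norm `∫ ‖k‖`, as an extended nonnegative real, is invariant under dilation of the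
symbol. -/
lemma lintegral_ker_dilate (c : ℝˣ) (a : Sch d) :
    ∫⁻ x, ‖ker (dilate c a) x‖ₑ = ∫⁻ x, ‖ker a x‖ₑ := by
  have hc : (c : ℝ) ≠ 0 := c.ne_zero
  have hc' : 0 < |(c : ℝ) ^ d| := abs_pos.2 (pow_ne_zero _ hc)
  rw [← ofReal_integral_norm_eq_lintegral_enorm (ker (dilate c a)).integrable,
    ← ofReal_integral_norm_eq_lintegral_enorm (ker a).integrable]
  simp_rw [ker_dilate, norm_mul, Complex.norm_real]
  rw [integral_const_mul, Measure.integral_comp_smul volume (fun x => ‖ker a x‖) (c : ℝ)⁻¹,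
    finrank_euclideanSpace_fin, inv_pow, inv_inv, smul_eq_mul, ← mul_assoc,
    Real.norm_of_nonneg (by positivity), inv_mul_cancel₀ hc'.ne', one_mul]

/-- Polynomial decay of any order of a Schwartz function. -/
lemma exists_decay (f : Sch d) (N : ℕ) :
    ∃ A : ℝ, 0 ≤ A ∧ ∀ x, ‖f x‖ ≤ A * ((1 + ‖x‖) ^ N)⁻¹ := by
  refine ⟨2 ^ N * ((Finset.Iic (N, 0)).sup fun m => SchwartzMap.seminorm ℝ m.1 m.2) f,
    by positivity, fun x => ?_⟩
  have h := SchwartzMap.one_add_le_sup_seminorm_apply (𝕜 := ℝ) (m := (N, 0)) (k := N) (n := 0)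
    le_rfl le_rfl f x
  rw [norm_iteratedFDeriv_zero] at h
  rw [← div_eq_mul_inv, le_div_iff₀ (by positivity)]
  linarith

end Schwartz

/-! ### Geometry of the fake unstable leaves -/

section Leaves

variable {d ds du : ℕ}

lemma ConeSystem.zero_mem_plus (Θ : ConeSystem d ds du) : (0 : Eu d) ∈ Θ.Cplus := by
  have : (0 : Eu d) ∈ Θ.Cplus ∩ Θ.Cminus := by rw [Θ.transversal]; rfl
  exact this.1

lemma ConeSystem.zero_mem_minus (Θ : ConeSystem d ds du) : (0 : Eu d) ∈ Θ.Cminus := by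
  have : (0 : Eu d) ∈ Θ.Cplus ∩ Θ.Cminus := by rw [Θ.transversal]; rfl
  exact this.2

lemma ConeSystem.Below.mem_plus_or {Θ Θ' : ConeSystem d ds du} (h : Θ.Below Θ') (x : Eu d) :
    x ∈ Θ'.Cplus ∨ x ∈ Θ.Cminus := by
  by_contra! hx
  rcases h (subset_closure hx.1) with h1 | h1
  · exact hx.2 (interior_subset h1)
  · rw [mem_singleton_iff] at h1
    exact hx.2 (h1 ▸ Θ.zero_mem_minus)

lemma ConeSystem.Below.plus_subset {Θ Θ' : ConeSystem d ds du} (h : Θ.Below Θ') :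
    Θ.Cplus ⊆ Θ'.Cplus := by
  intro x hx
  rcases h.mem_plus_or x with h1 | h1
  · exact h1
  · have : x ∈ Θ.Cplus ∩ Θ.Cminus := ⟨hx, h1⟩
    rw [Θ.transversal, mem_singleton_iff] at this
    exact this ▸ Θ'.zero_mem_plus

lemma ConeSystem.Below.leaves_subset {Θ Θ' : ConeSystem d ds du} (h : Θ.Below Θ') :
    Θ.leaves ⊆ Θ'.leaves := by
  rintro Γ ⟨h1, h2⟩
  refine ⟨h1, fun x hx y hy hxy => ?_⟩
  obtain ⟨W, hW, hW', hn⟩ := h2 x hx y hy hxy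
  exact ⟨W, hW, hW'.trans h.plus_subset, hn⟩

lemma ConeSystem.Below.leafNorm_le {Θ Θ' : ConeSystem d ds du} (h : Θ.Below Θ') (f : Eu d → ℂ) :
    leafNorm Θ f ≤ leafNorm Θ' f :=
  biSup_mono fun _ hΓ => h.leaves_subset hΓ

/-- The cones `C₊` and `C₋` are separated by a positive angle. -/
lemma ConeSystem.exists_angle (Θ : ConeSystem d ds du) :
    ∃ c : ℝ, 0 < c ∧ ∀ a ∈ Θ.Cplus, ∀ b ∈ Θ.Cminus, c * ‖b‖ ≤ ‖a + b‖ := by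
  have hS : IsCompact (Metric.sphere (0 : Eu d) 1 ∩ Θ.Cminus) :=
    (isCompact_sphere 0 1).inter_right Θ.closed_minus
  have hdis : Disjoint (Metric.sphere (0 : Eu d) 1 ∩ Θ.Cminus) Θ.Cplus := by
    rw [Set.disjoint_left]
    rintro x ⟨hx1, hx2⟩ hx3
    have : x ∈ Θ.Cplus ∩ Θ.Cminus := ⟨hx3, hx2⟩
    rw [Θ.transversal, mem_singleton_iff] at this
    simp [this] at hx1
  obtain ⟨r, hr, h⟩ := Metric.exists_pos_forall_lt_edist hS Θ.closed_plus hdis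
  refine ⟨r, hr, fun a ha b hb => ?_⟩
  rcases eq_or_ne b 0 with rfl | hb0
  · simp
  have hn : 0 < ‖b‖ := norm_pos_iff.2 hb0
  have h1 := h (‖b‖⁻¹ • b) ⟨by simp [norm_smul, hn.ne'], Θ.cone_minus _ _ hb⟩
    ((-‖b‖⁻¹) • a) (Θ.cone_plus _ _ ha)
  rw [edist_dist, ← ENNReal.ofReal_coe_nnreal, ENNReal.ofReal_lt_ofReal_iff_of_nonneg r.coe_nonneg,
    dist_eq_norm] at h1
  have h2 : ‖b‖⁻¹ • b - (-‖b‖⁻¹) • a = ‖b‖⁻¹ • (a + b) := by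
    rw [smul_add, neg_smul]; abel
  rw [h2, norm_smul, norm_inv, norm_norm, inv_mul_eq_div, lt_div_iff₀ hn] at h1
  exact h1.le

/-- Leaves are uniformly Lipschitz graphs: along a leaf, distances are controlled by those of the
orthogonal projections to a `du`-dimensional subspace of `C₋`. -/
lemma ConeSystem.exists_projection (Θ : ConeSystem d ds du) :
    ∃ (c : ℝ≥0) (W : Submodule ℝ (Eu d)), Module.finrank ℝ W = du ∧
      ∀ Γ ∈ Θ.leaves, ∀ x ∈ Γ, ∀ y ∈ Γ,
        edist x y ≤ c * edist (W.orthogonalProjectionOnto x) (W.orthogonalProjectionOnto y) := by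
  obtain ⟨c, hc, hang⟩ := Θ.exists_angle
  obtain ⟨Wm, hWm, hWm'⟩ := Θ.dim_minus.2.1
  refine ⟨c⁻¹.toNNReal, Wm, hWm, fun Γ hΓ x hx y hy => ?_⟩
  rcases eq_or_ne x y with rfl | hxy
  · simp
  obtain ⟨W, hW, hW', hn⟩ := hΓ.2 x hx y hy hxy
  have hdisj : Disjoint W Wm := by
    rw [Submodule.disjoint_def]
    intro v hv hv'
    have : v ∈ Θ.Cplus ∩ Θ.Cminus := ⟨hW' hv, hWm' hv'⟩
    rwa [Θ.transversal] at this
  have htop : W ⊔ Wm = ⊤ := by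
    apply Submodule.eq_top_of_disjoint _ _ _ hdisj
    rw [hW, hWm, finrank_euclideanSpace_fin, Θ.dim_add]
  -- The leaf direction `y - x` is normal to `W`, so only its component `b` along `Wm` contributes
  -- to `‖y - x‖ ^ 2`.
  obtain ⟨a, ha, b, hb, hab⟩ := Submodule.mem_sup.1 (htop ▸ Submodule.mem_top : y - x ∈ W ⊔ Wm)
  have hpos : 0 < ‖y - x‖ := norm_pos_iff.2 (sub_ne_zero.2 hxy.symm)
  have h1 : ‖y - x‖ * ‖y - x‖ = ⟪y - x, b⟫ := by
    rw [← real_inner_self_eq_norm_mul_norm]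
    conv_lhs => rw [← hab, inner_add_right, hab, hn a ha, zero_add]
  have h2 : ⟪y - x, b⟫ = ⟪Wm.orthogonalProjectionOnto (y - x), (⟨b, hb⟩ : Wm)⟫ :=
    (Submodule.inner_orthogonalProjectionOnto_eq_of_mem_right ⟨b, hb⟩ (y - x)).symm
  have h3 : ⟪Wm.orthogonalProjectionOnto (y - x), (⟨b, hb⟩ : Wm)⟫ ≤
      ‖Wm.orthogonalProjectionOnto (y - x)‖ * ‖b‖ := real_inner_le_norm _ _
  have h4 : c * ‖b‖ ≤ ‖y - x‖ := hab ▸ hang a (hW' ha) b (hWm' hb)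
  have h5 : c * ‖y - x‖ ≤ ‖Wm.orthogonalProjectionOnto (y - x)‖ := by
    have h6 : c * ‖y - x‖ * ‖y - x‖ ≤ ‖Wm.orthogonalProjectionOnto (y - x)‖ * ‖y - x‖ := by
      calc c * ‖y - x‖ * ‖y - x‖ = c * (‖y - x‖ * ‖y - x‖) := by ring
        _ ≤ c * (‖Wm.orthogonalProjectionOnto (y - x)‖ * ‖b‖) := by
          rw [h1, h2]; gcongr
        _ = ‖Wm.orthogonalProjectionOnto (y - x)‖ * (c * ‖b‖) := by ring
        _ ≤ _ := by gcongr
    exact le_of_mul_le_mul_right h6 hpos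
  rw [edist_comm x y, edist_comm (Wm.orthogonalProjectionOnto x), edist_nndist, edist_nndist,
    ← ENNReal.coe_mul, ENNReal.coe_le_coe, ← NNReal.coe_le_coe]
  push_cast
  rw [dist_eq_norm, dist_eq_norm, ← map_sub, Real.coe_toNNReal _ (inv_nonneg.2 hc.le),
    inv_mul_eq_div, le_div_iff₀ hc]
  linarith

lemma euclideanHausdorffMeasure_le_of_antilipschitzOn {X Y : Type*} [EMetricSpace X]
    [MeasurableSpace X] [BorelSpace X] [EMetricSpace Y] [MeasurableSpace Y] [BorelSpace Y]
    (n : ℕ) {s : Set X} {f : X → Y} {c : ℝ≥0}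
    (h : ∀ x ∈ s, ∀ y ∈ s, edist x y ≤ c * edist (f x) (f y)) :
    Measure.euclideanHausdorffMeasure n s ≤
      (c : ℝ≥0∞) ^ n * Measure.euclideanHausdorffMeasure n (f '' s) := by
  have ha : AntilipschitzWith c (fun x : s => f x) := fun x y => h x x.2 y y.2
  have h1 := ha.le_hausdorffMeasure_image (d := n) (by positivity) univ
  rw [← isometry_subtype_coe.hausdorffMeasure_image (Or.inl (by positivity)), image_univ,
    Subtype.range_coe] at h1
  have h2 : (fun x : s => f x) '' univ = f '' s := by
    rw [image_univ]; ext; simp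
  rw [h2, ENNReal.rpow_natCast] at h1
  simp only [Measure.euclideanHausdorffMeasure_def, Measure.smul_apply]
  rw [ENNReal.smul_def, ENNReal.smul_def, smul_eq_mul, smul_eq_mul, mul_left_comm]
  gcongr

lemma lintegral_decay_lt_top {V : Type*} [NormedAddCommGroup V] [InnerProductSpace ℝ V]
    [FiniteDimensional ℝ V] [MeasurableSpace V] [BorelSpace V] {N : ℕ}
    (h : Module.finrank ℝ V < N) :
    ∫⁻ x : V, ENNReal.ofReal ((1 + ‖x‖) ^ N)⁻¹ < ⊤ := by
  have := finite_integral_one_add_norm (E := V) (μ := volume) (r := N) (by exact_mod_cast h)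
  refine lt_of_le_of_lt (lintegral_mono fun x => le_of_eq ?_) this
  rw [Real.rpow_neg (by positivity), Real.rpow_natCast]

/-- The orthogonal projections of the volume of the leaves to a `du`-dimensional subspace of `C₋`
are uniformly bounded by Lebesgue measure. -/
lemma ConeSystem.exists_map_le (Θ : ConeSystem d ds du) :
    ∃ (c : ℝ≥0) (W : Submodule ℝ (Eu d)), Module.finrank ℝ W = du ∧
      ∀ Γ ∈ Θ.leaves, ((Measure.euclideanHausdorffMeasure du).restrict Γ).map
        W.orthogonalProjectionOnto ≤ c • (volume : Measure W) := by
  obtain ⟨c, W, hW, h⟩ := Θ.exists_projection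
  refine ⟨c ^ du, W, hW, fun Γ hΓ => Measure.le_iff.2 fun B hB => ?_⟩
  have hP : Measurable (W.orthogonalProjectionOnto : Eu d → W) := by fun_prop
  rw [Measure.map_apply hP hB, Measure.restrict_apply (hP hB), Measure.smul_apply,
    ENNReal.smul_def, smul_eq_mul, ← InnerProductSpace.euclideanHausdorffMeasure_eq_volume, hW,
    ENNReal.coe_pow]
  refine (euclideanHausdorffMeasure_le_of_antilipschitzOn du
    (f := (W.orthogonalProjectionOnto : Eu d → W))
    fun x hx y hy => h Γ hΓ x hx.2 y hy.2).trans ?_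
  gcongr
  rintro _ ⟨x, hx, rfl⟩
  exact hx.1

/-- The volume of a leaf is s-finite, as needed for Tonelli's theorem; a leaf is not assumed to be
closed or measurable. -/
lemma ConeSystem.sFinite_leaf (Θ : ConeSystem d ds du) {Γ : Set (Eu d)} (hΓ : Γ ∈ Θ.leaves) :
    SFinite ((Measure.euclideanHausdorffMeasure du : Measure (Eu d)).restrict Γ) := by
  obtain ⟨c, W, hW, h⟩ := Θ.exists_map_le
  have hP : Measurable (W.orthogonalProjectionOnto : Eu d → W) := by fun_prop
  have : SigmaFinite (c • (volume : Measure W)) := inferInstance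
  have h2 := Measure.sigmaFinite_of_le _ (h Γ hΓ)
  have := SigmaFinite.of_map _ hP.aemeasurable h2
  infer_instance

/-- Functions that decay fast enough have finite leaf norm. -/
lemma ConeSystem.exists_leafNorm_le_of_decay (Θ : ConeSystem d ds du) :
    ∃ C : ℝ≥0, ∀ (A : ℝ) (g : Eu d → ℂ), (∀ x, ‖g x‖ ≤ A * ((1 + ‖x‖) ^ (du + 1))⁻¹) →
      leafNorm Θ g ≤ C * ENNReal.ofReal A := by
  obtain ⟨c, W, hW, h⟩ := Θ.exists_map_le
  have hJ := lintegral_decay_lt_top (V := W) (N := du + 1) (by rw [hW]; exact Nat.lt_succ_self _)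
  obtain ⟨J, hJdef⟩ : ∃ J : ℝ≥0, (J : ℝ≥0∞) = ∫⁻ x : W, ENNReal.ofReal ((1 + ‖x‖) ^ (du + 1))⁻¹ :=
    ⟨_, ENNReal.coe_toNNReal hJ.ne⟩
  refine ⟨c * J, fun A g hg => iSup₂_le fun Γ hΓ => ?_⟩
  have hA : 0 ≤ A := by
    have := (norm_nonneg _).trans (hg 0)
    simpa using this
  have hP : Measurable (W.orthogonalProjectionOnto : Eu d → W) := by fun_prop
  have hm : Measurable fun u : W => ENNReal.ofReal A * ENNReal.ofReal ((1 + ‖u‖) ^ (du + 1))⁻¹ := by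
    fun_prop
  calc ∫⁻ x in Γ, ‖g x‖ₑ ∂(Measure.euclideanHausdorffMeasure du)
      ≤ ∫⁻ x in Γ, ENNReal.ofReal A *
          ENNReal.ofReal ((1 + ‖W.orthogonalProjectionOnto x‖) ^ (du + 1))⁻¹
          ∂(Measure.euclideanHausdorffMeasure du) := by
        refine lintegral_mono fun x => ?_
        rw [← ENNReal.ofReal_mul hA, ← ofReal_norm]
        refine ENNReal.ofReal_le_ofReal ((hg x).trans ?_)
        gcongr
        exact W.norm_orthogonalProjectionOnto_apply_le x
    _ = ∫⁻ u, ENNReal.ofReal A * ENNReal.ofReal ((1 + ‖u‖) ^ (du + 1))⁻¹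
          ∂(((Measure.euclideanHausdorffMeasure du).restrict Γ).map
            W.orthogonalProjectionOnto) := (lintegral_map hm hP).symm
    _ ≤ ∫⁻ u, ENNReal.ofReal A * ENNReal.ofReal ((1 + ‖u‖) ^ (du + 1))⁻¹
          ∂(c • (volume : Measure W)) := lintegral_mono' (h Γ hΓ) le_rfl
    _ = _ := by
      rw [lintegral_smul_measure, lintegral_const_mul' _ _ ENNReal.ofReal_ne_top, ← hJdef,
        ENNReal.smul_def, smul_eq_mul, ENNReal.coe_mul]
      ring

lemma ConeSystem.translate_mem_leaves (Θ : ConeSystem d ds du) {Γ : Set (Eu d)}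
    (hΓ : Γ ∈ Θ.leaves) (z : Eu d) : (fun x => x - z) '' Γ ∈ Θ.leaves := by
  refine ⟨?_, ?_⟩
  · rintro _ ⟨x, hx, rfl⟩
    obtain ⟨e, W, hxe, h1, h2, h3, h4⟩ := hΓ.1 x hx
    refine ⟨(Homeomorph.addRight z).transOpenPartialHomeomorph e, W, by simpa using hxe, ?_, ?_, h3,
      ?_⟩
    · exact h1.comp (contDiff_id.add contDiff_const).contDiffOn fun y hy => by simpa using hy
    · exact h2.sub contDiffOn_const
    · rw [Homeomorph.transOpenPartialHomeomorph_target, ← h4]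
      ext y
      constructor
      · rintro ⟨_, ⟨h5, ⟨w, hw, rfl⟩⟩, rfl⟩
        exact ⟨w, ⟨by simpa using h5, hw⟩, by simp⟩
      · rintro ⟨w, ⟨h5, hw⟩, rfl⟩
        exact ⟨w - z, ⟨by simpa using h5, ⟨w, hw, rfl⟩⟩, by simp⟩
  · rintro _ ⟨x, hx, rfl⟩ _ ⟨y, hy, rfl⟩ hxy
    obtain ⟨W, a, b, c⟩ := hΓ.2 x hx y hy (fun h => hxy (by rw [h]))
    exact ⟨W, a, b, by simpa using c⟩

lemma ConeSystem.setLIntegral_translate_le (Θ : ConeSystem d ds du) {Γ : Set (Eu d)}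
    (hΓ : Γ ∈ Θ.leaves) (f : Eu d → ℂ) (z : Eu d) :
    ∫⁻ x in Γ, ‖f (x - z)‖ₑ ∂(Measure.euclideanHausdorffMeasure du) ≤ leafNorm Θ f := by
  have hmp : MeasurePreserving (fun x : Eu d => x - z)
      (Measure.euclideanHausdorffMeasure du) (Measure.euclideanHausdorffMeasure du) :=
    (IsometryEquiv.subRight z).measurePreserving_euclideanHausdorffMeasure du
  rw [hmp.setLIntegral_comp_emb (Homeomorph.subRight z).measurableEmbedding (fun x => ‖f x‖ₑ) Γ]
  exact le_iSup₂ (f := fun (Γ : Set (Eu d)) (_ : Γ ∈ Θ.leaves) =>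
    ∫⁻ x in Γ, ‖f x‖ₑ ∂(Measure.euclideanHausdorffMeasure du)) _ (Θ.translate_mem_leaves hΓ z)

/-- Convolution with an integrable kernel is bounded for the leaf norm, because the family of
leaves is invariant under translation. -/
lemma ConeSystem.leafNorm_convS_le (Θ : ConeSystem d ds du) (k f : Sch d) :
    leafNorm Θ (convS k f) ≤ (∫⁻ z, ‖k z‖ₑ) * leafNorm Θ f := by
  refine iSup₂_le fun Γ hΓ => ?_
  have := Θ.sFinite_leaf hΓ
  calc ∫⁻ x in Γ, ‖convS k f x‖ₑ ∂(Measure.euclideanHausdorffMeasure du)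
      ≤ ∫⁻ x in Γ, (∫⁻ z, ‖k z‖ₑ * ‖f (x - z)‖ₑ) ∂(Measure.euclideanHausdorffMeasure du) := by
        refine lintegral_mono fun x => ?_
        rw [convS, SchwartzMap.convolution_apply]
        refine (enorm_integral_le_lintegral_enorm _).trans (lintegral_mono fun z => ?_)
        simp
    _ = ∫⁻ z, ∫⁻ x in Γ, ‖k z‖ₑ * ‖f (x - z)‖ₑ ∂(Measure.euclideanHausdorffMeasure du) := by
        rw [lintegral_lintegral_swap]
        have : Continuous (Function.uncurry fun x z : Eu d => ‖k z‖ₑ * ‖f (x - z)‖ₑ) := by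
          have h1 : Continuous fun p : Eu d × Eu d => ‖k p.2 * f (p.1 - p.2)‖ₑ := by fun_prop
          refine h1.congr fun p => ?_
          simp [Function.uncurry]
        exact this.measurable.aemeasurable
    _ ≤ ∫⁻ z, ‖k z‖ₑ * leafNorm Θ f := by
        refine lintegral_mono fun z => ?_
        rw [lintegral_const_mul' _ _ enorm_ne_top]
        gcongr
        exact Θ.setLIntegral_translate_le hΓ f z
    _ = _ := by
        rw [lintegral_mul_const]
        exact (k.continuous.enorm).measurable

/-- The affine subspaces normal to a `ds`-dimensional subspace of `C₊` are leaves. -/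
lemma ConeSystem.affine_mem_leaves (Θ : ConeSystem d ds du) {W : Submodule ℝ (Eu d)}
    (hW : Module.finrank ℝ W = ds) (hW' : (W : Set (Eu d)) ⊆ Θ.Cplus) (w : Eu d) :
    range (fun v : Wᗮ => w + (v : Eu d)) ∈ Θ.leaves := by
  refine ⟨?_, ?_⟩
  · rintro _ ⟨v, rfl⟩
    refine ⟨(Homeomorph.subRight w).toOpenPartialHomeomorph, Wᗮ, by simp, ?_, ?_, ?_, ?_⟩
    · exact (contDiff_id.sub contDiff_const).contDiffOn
    · exact (contDiff_id.add contDiff_const).contDiffOn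
    · have := W.finrank_add_finrank_orthogonal
      rw [finrank_euclideanSpace_fin, hW] at this
      have := Θ.dim_add
      omega
    · ext y
      constructor
      · rintro ⟨_, ⟨-, v, rfl⟩, rfl⟩
        simp
      · rintro ⟨-, hy⟩
        exact ⟨w + y, ⟨by simp, ⟨⟨y, hy⟩, rfl⟩⟩, by simp⟩
  · rintro _ ⟨x, rfl⟩ _ ⟨y, rfl⟩ -
    refine ⟨W, hW, hW', fun u hu => ?_⟩
    have h := Submodule.inner_left_of_mem_orthogonal hu (Wᗮ.sub_mem y.2 x.2)
    simpa using h

/-- The space is foliated by the translates of a `du`-dimensional subspace normal to a subspace of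
`C₊`; integrating over the transversal, the leaf norm controls integrals against functions that
decay fast enough. -/
lemma ConeSystem.exists_lintegral_mul_le (Θ : ConeSystem d ds du) :
    ∃ C : ℝ≥0, ∀ (A : ℝ) (h g : Eu d → ℂ), Measurable h →
      (∀ z, ‖g z‖ ≤ A * ((1 + ‖z‖) ^ (d + 1))⁻¹) → ∀ x,
      ∫⁻ y, ‖g (x - y)‖ₑ * ‖h y‖ₑ ≤ C * ENNReal.ofReal A * leafNorm Θ h := by
  obtain ⟨W, hW, hW'⟩ := Θ.dim_plus.2.1
  have hd := Θ.dim_add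
  have hJ := lintegral_decay_lt_top (V := W) (N := d + 1) (by rw [hW]; omega)
  obtain ⟨J, hJdef⟩ : ∃ J : ℝ≥0, (J : ℝ≥0∞) = ∫⁻ x : W, ENNReal.ofReal ((1 + ‖x‖) ^ (d + 1))⁻¹ :=
    ⟨_, ENNReal.coe_toNNReal hJ.ne⟩
  refine ⟨J, fun A h g hh hg x => ?_⟩
  have hA : 0 ≤ A := by
    have := (norm_nonneg _).trans (hg 0)
    simpa using this
  let G : Eu d → ℝ≥0∞ := fun y => ENNReal.ofReal A *
    ENNReal.ofReal ((1 + ‖W.orthogonalProjectionOnto (x - y)‖) ^ (d + 1))⁻¹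
  have hG : Measurable G := by fun_prop
  have hF : Measurable fun y => G y * ‖h y‖ₑ := hG.mul hh.enorm
  have hvol : (volume : Measure (Eu d)) = Measure.euclideanHausdorffMeasure
      (Module.finrank ℝ (Eu d)) := InnerProductSpace.euclideanHausdorffMeasure_eq_volume.symm
  have hWd : Module.finrank ℝ Wᗮ = du := by
    have := W.finrank_add_finrank_orthogonal
    rw [finrank_euclideanSpace_fin, hW] at this
    omega
  calc ∫⁻ y, ‖g (x - y)‖ₑ * ‖h y‖ₑ ≤ ∫⁻ y, G y * ‖h y‖ₑ := by
        refine lintegral_mono fun y => ?_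
        gcongr
        simp only [G]
        rw [← ENNReal.ofReal_mul hA, ← ofReal_norm]
        refine ENNReal.ofReal_le_ofReal ((hg _).trans ?_)
        gcongr
        exact W.norm_orthogonalProjectionOnto_apply_le _
    _ = ∫⁻ p : W × Wᗮ, G (p.1 + p.2) * ‖h (p.1 + p.2)‖ₑ := by
        have hmp := (W.measurePreserving_measurableEquivProd (0 : Eu d)).symm
        rw [hvol, ← hmp.lintegral_comp hF]
        simp
    _ = ∫⁻ w : W, ∫⁻ v : Wᗮ, G (w + v) * ‖h (w + v)‖ₑ := by
        rw [Measure.volume_eq_prod, lintegral_prod]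
        exact (hF.comp (by fun_prop)).aemeasurable
    _ ≤ ∫⁻ w : W, ENNReal.ofReal A *
          ENNReal.ofReal ((1 + ‖W.orthogonalProjectionOnto x - w‖) ^ (d + 1))⁻¹ *
            leafNorm Θ h := by
        refine lintegral_mono fun w => ?_
        have h1 : ∀ v : Wᗮ, G (w + v) = ENNReal.ofReal A *
            ENNReal.ofReal ((1 + ‖W.orthogonalProjectionOnto x - w‖) ^ (d + 1))⁻¹ := by
          intro v
          simp only [G]
          rw [map_sub, map_add, Submodule.orthogonalProjectionOnto_mem_subspace_eq_self,
            Submodule.orthogonalProjectionOnto_eq_zero_iff.2 v.2, add_zero]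
        simp_rw [h1]
        rw [lintegral_const_mul' _ _ (ENNReal.mul_ne_top ENNReal.ofReal_ne_top
          ENNReal.ofReal_ne_top)]
        gcongr
        have hiso : Isometry fun v : Wᗮ => (w : Eu d) + (v : Eu d) :=
          (isometry_add_left (w : Eu d)).comp isometry_subtype_coe
        have h2 : (volume : Measure Wᗮ) = Measure.euclideanHausdorffMeasure du := by
          rw [← hWd, InnerProductSpace.euclideanHausdorffMeasure_eq_volume]
        rw [h2, ← lintegral_map (f := fun y => ‖h y‖ₑ) hh.enorm hiso.continuous.measurable,
          hiso.map_euclideanHausdorffMeasure]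
        exact le_iSup₂ (f := fun (Γ : Set (Eu d)) (_ : Γ ∈ Θ.leaves) =>
          ∫⁻ x in Γ, ‖h x‖ₑ ∂(Measure.euclideanHausdorffMeasure du)) _
          (Θ.affine_mem_leaves hW hW' w)
    _ = _ := by
        rw [lintegral_mul_const _ (by fun_prop), lintegral_const_mul' _ _ ENNReal.ofReal_ne_top,
          lintegral_sub_left_eq_self (fun w : W => ENNReal.ofReal ((1 + ‖w‖) ^ (d + 1))⁻¹),
          ← hJdef, mul_comm (ENNReal.ofReal A)]

end Leaves

/-! ### The dyadic symbols -/

section Symbols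

variable {d ds du : ℕ}

lemma Cutoff.contDiff_norm (χ : Cutoff) (c : ℝ) :
    ContDiff ℝ ∞ fun ξ : Eu d => χ.toFun (c * ‖ξ‖) := by
  rw [contDiff_iff_contDiffAt]
  intro ξ
  rcases eq_or_ne ξ 0 with rfl | hξ
  · refine (contDiffAt_const (c := (1 : ℝ))).congr_of_eventuallyEq ?_
    have hc : Filter.Tendsto (fun ξ : Eu d => |c * ‖ξ‖|) (nhds 0) (nhds |c * ‖(0 : Eu d)‖|) := by
      have : Continuous fun ξ : Eu d => |c * ‖ξ‖| := by fun_prop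
      exact this.tendsto 0
    simp only [norm_zero, mul_zero, abs_zero] at hc
    filter_upwards [hc.eventually_le_const zero_lt_one] with ξ h
    exact χ.eq_one _ h
  · exact χ.smooth.contDiffAt.comp ξ (contDiffAt_const.mul (contDiffAt_norm ℝ hξ))

lemma contDiff_mul_of_eq_zero_near {u v : Eu d → ℝ} (hu : ContDiffOn ℝ ∞ u {0}ᶜ)
    (hv : ContDiff ℝ ∞ v) {r : ℝ} (hr : 0 < r) (h0 : ∀ ξ, ‖ξ‖ ≤ r → v ξ = 0) :
    ContDiff ℝ ∞ fun ξ => u ξ * v ξ := by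
  rw [contDiff_iff_contDiffAt]
  intro ξ
  rcases eq_or_ne ξ 0 with rfl | hξ
  · refine (contDiffAt_const (c := (0 : ℝ))).congr_of_eventuallyEq ?_
    filter_upwards [Metric.ball_mem_nhds (0 : Eu d) hr] with ξ h
    rw [h0 ξ (by simpa using (mem_ball_zero_iff.1 h).le), mul_zero]
  · exact (hu.contDiffAt (isOpen_compl_singleton.mem_nhds hξ)).mul hv.contDiffAt

/-- A smooth real function that vanishes outside a ball, as a complex Schwartz function. -/
def symbol (u : Eu d → ℝ) (hu : ContDiff ℝ ∞ u) (r : ℝ) (hr : ∀ ξ, r ≤ ‖ξ‖ → u ξ = 0) : Sch d :=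
  HasCompactSupport.toSchwartzMap (f := fun ξ => (u ξ : ℂ))
    (HasCompactSupport.intro (isCompact_closedBall 0 r) fun ξ hξ => by
      rw [hr ξ (by simpa using (not_le.1 fun h => hξ (by simpa using h)).le), Complex.ofReal_zero])
    (Complex.ofRealCLM.contDiff.comp hu)

@[simp] lemma symbol_apply (u : Eu d → ℝ) (hu : ContDiff ℝ ∞ u) (r : ℝ)
    (hr : ∀ ξ, r ≤ ‖ξ‖ → u ξ = 0) (ξ : Eu d) : symbol u hu r hr ξ = (u ξ : ℂ) := rfl

lemma Cutoff.eq_one_of_le (χ : Cutoff) {x : ℝ} (h0 : 0 ≤ x) (h : x ≤ 1) : χ.toFun x = 1 :=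
  χ.eq_one x (by rwa [abs_of_nonneg h0])

lemma Cutoff.eq_zero_of_le (χ : Cutoff) {x : ℝ} (h : 2 ≤ x) : χ.toFun x = 0 :=
  χ.eq_zero x (h.trans (le_abs_self x))

lemma dyadic_succ_eq_zero_of_le (χ : Cutoff) {n : ℕ} {ξ : Eu d} (h : ‖ξ‖ ≤ 2 ^ n) :
    dyadic χ (n + 1) ξ = 0 := by
  have hp : (0 : ℝ) < 2 ^ n := by positivity
  rw [dyadic, χ.eq_one_of_le (by positivity), χ.eq_one_of_le (by positivity), sub_self]
  · rw [inv_mul_eq_div, div_le_one hp]; exact h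
  · rw [inv_mul_eq_div, div_le_one (by positivity), pow_succ]; linarith

lemma dyadic_succ_eq_zero_of_ge (χ : Cutoff) {n : ℕ} {ξ : Eu d} (h : 2 ^ (n + 2) ≤ ‖ξ‖) :
    dyadic χ (n + 1) ξ = 0 := by
  have hp : (0 : ℝ) < 2 ^ n := by positivity
  have h' : 4 * 2 ^ n ≤ ‖ξ‖ := by rw [pow_succ, pow_succ] at h; linarith
  rw [dyadic, χ.eq_zero_of_le, χ.eq_zero_of_le, sub_self]
  · rw [inv_mul_eq_div, le_div_iff₀ hp]; linarith
  · rw [inv_mul_eq_div, le_div_iff₀ (by positivity), pow_succ]; linarith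

lemma ConeSystem.contDiffOn_Phi (Θ : ConeSystem d ds du) (σ : Sgn) :
    ContDiffOn ℝ ∞ (fun ξ : Eu d => Θ.Phi σ (‖ξ‖⁻¹ • ξ)) {0}ᶜ := by
  cases σ
  · exact Θ.smooth
  · exact contDiffOn_const.sub Θ.smooth

lemma contDiff_dyadic_succ (χ : Cutoff) (n : ℕ) :
    ContDiff ℝ ∞ (dyadic χ (n + 1) : Eu d → ℝ) :=
  (χ.contDiff_norm _).sub (χ.contDiff_norm _)

lemma contDiff_psi (χ : Cutoff) (Θ : ConeSystem d ds du) (n : ℕ) (σ : Sgn) :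
    ContDiff ℝ ∞ (psi χ Θ n σ) := by
  cases n with
  | zero =>
    have h := (χ.contDiff_norm (d := d) 1).div_const 2
    simp only [one_mul] at h
    exact h
  | succ n =>
    exact contDiff_mul_of_eq_zero_near (Θ.contDiffOn_Phi σ) (contDiff_dyadic_succ χ n)
      (r := 2 ^ n) (by positivity) fun ξ h => dyadic_succ_eq_zero_of_le χ h

lemma psi_eq_zero_of_ge (χ : Cutoff) (Θ : ConeSystem d ds du) (n : ℕ) (σ : Sgn) (ξ : Eu d)
    (h : 2 ^ (n + 1) ≤ ‖ξ‖) : psi χ Θ n σ ξ = 0 := by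
  cases n with
  | zero => rw [psi, χ.eq_zero_of_le (by simpa using h), zero_div]
  | succ n => rw [psi, dyadic_succ_eq_zero_of_ge χ h, mul_zero]

/-- The symbol `ψ_{Θ,n,σ}` as a Schwartz function. -/
def psiS (χ : Cutoff) (Θ : ConeSystem d ds du) (n : ℕ) (σ : Sgn) : Sch d :=
  symbol (psi χ Θ n σ) (contDiff_psi χ Θ n σ) (2 ^ (n + 1)) (psi_eq_zero_of_ge χ Θ n σ)

@[simp] lemma psiS_apply (χ : Cutoff) (Θ : ConeSystem d ds du) (n : ℕ) (σ : Sgn) (ξ : Eu d) :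
    psiS χ Θ n σ ξ = (psi χ Θ n σ ξ : ℂ) := rfl

/-- The component `φ_{Θ,n,σ}` as a Schwartz function. -/
def comp (χ : Cutoff) (Θ : ConeSystem d ds du) (n : ℕ) (σ : Sgn) (f : Sch d) : Sch d :=
  convS (ker (psiS χ Θ n σ)) f

lemma component_eq (χ : Cutoff) (Θ : ConeSystem d ds du) (n : ℕ) (σ : Sgn) (f : Sch d) :
    component χ Θ n σ f = comp χ Θ n σ f := by
  funext x
  rw [comp, convS_apply]
  refine integral_congr_ae (Filter.Eventually.of_forall fun y => ?_)
  simp only [invFourier, ker_eq_integral, psiS_apply]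

lemma fourier_comp (χ : Cutoff) (Θ : ConeSystem d ds du) (n : ℕ) (σ : Sgn) (f : Sch d)
    (ξ : Eu d) :
    𝓕 (comp χ Θ n σ f) ξ = (psi χ Θ n σ ((2 * Real.pi) • ξ) : ℂ) * 𝓕 f ξ := by
  rw [comp, fourier_convS_ker, psiS_apply]

/-- The symbols of positive index are dilates of a single one, so their kernels have equal
`L¹` norms. -/
lemma psiS_succ (χ : Cutoff) (Θ : ConeSystem d ds du) (n : ℕ) (σ : Sgn) :
    psiS χ Θ (n + 1) σ = dilate (scale n) (psiS χ Θ 1 σ) := by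
  ext ξ
  rw [dilate_apply, psiS_apply, psiS_apply, psi, psi, coe_scale, dyadic, dyadic]
  have hp : (0 : ℝ) < (2 ^ n)⁻¹ := by positivity
  have h1 : ‖((2 : ℝ) ^ n)⁻¹ • ξ‖ = (2 ^ n)⁻¹ * ‖ξ‖ := by
    rw [norm_smul, Real.norm_of_nonneg hp.le]
  have h2 : (‖((2 : ℝ) ^ n)⁻¹ • ξ‖)⁻¹ • ((2 : ℝ) ^ n)⁻¹ • ξ = ‖ξ‖⁻¹ • ξ := by
    rw [h1, smul_smul]
    congr 1
    field_simp
  rw [h2, h1]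
  congr 4
  · rw [pow_succ, mul_inv, zero_add, pow_one]; ring
  · simp

lemma psi_plus_add_psi_minus (χ : Cutoff) (Θ : ConeSystem d ds du) (n : ℕ) (ξ : Eu d) :
    psi χ Θ n .plus ξ + psi χ Θ n .minus ξ = dyadic χ n ξ := by
  cases n with
  | zero => simp [psi, dyadic]
  | succ n => simp only [psi, ConeSystem.Phi]; ring

lemma sum_dyadic (χ : Cutoff) (M : ℕ) (ξ : Eu d) :
    ∑ m ∈ Finset.range (M + 1), dyadic χ m ξ = χ.toFun ((2 ^ M)⁻¹ * ‖ξ‖) := by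
  induction M with
  | zero => simp [dyadic]
  | succ M ih => rw [Finset.sum_range_succ, ih, dyadic]; ring

/-- The three neighbouring dyadic shells cover a given one. -/
lemma dyadic_mul_neighbours (χ : Cutoff) (n : ℕ) (ξ : Eu d) :
    dyadic χ (n + 2) ξ * (dyadic χ (n + 1) ξ + dyadic χ (n + 2) ξ + dyadic χ (n + 3) ξ) =
      dyadic χ (n + 2) ξ := by
  rcases le_total ‖ξ‖ (2 ^ (n + 1)) with h | h
  · rw [dyadic_succ_eq_zero_of_le χ h, zero_mul]
  rcases le_total (2 ^ (n + 3)) ‖ξ‖ with h' | h'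
  · rw [dyadic_succ_eq_zero_of_ge χ h', zero_mul]
  have hp : (0 : ℝ) < 2 ^ n := by positivity
  have h1 : χ.toFun ((2 ^ (n + 3))⁻¹ * ‖ξ‖) = 1 := by
    refine χ.eq_one_of_le (by positivity) ?_
    rwa [inv_mul_eq_div, div_le_one (by positivity)]
  have h2 : χ.toFun ((2 ^ n)⁻¹ * ‖ξ‖) = 0 := by
    refine χ.eq_zero_of_le ?_
    rw [inv_mul_eq_div, le_div_iff₀ hp]
    rw [pow_succ] at h
    linarith
  have h3 : dyadic χ (n + 1) ξ + dyadic χ (n + 2) ξ + dyadic χ (n + 3) ξ = 1 := by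
    simp only [dyadic]
    rw [h1, h2]; ring
  rw [h3, mul_one]

lemma psi_minus_mul_neighbours (χ : Cutoff) (Θ Θ' : ConeSystem d ds du) (n : ℕ) (ξ : Eu d) :
    psi χ Θ (n + 2) .minus ξ * ((psi χ Θ' (n + 1) .plus ξ + psi χ Θ' (n + 1) .minus ξ) +
      (psi χ Θ' (n + 2) .plus ξ + psi χ Θ' (n + 2) .minus ξ) +
      (psi χ Θ' (n + 3) .plus ξ + psi χ Θ' (n + 3) .minus ξ)) = psi χ Θ (n + 2) .minus ξ := by
  simp only [psi_plus_add_psi_minus]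
  rw [psi, mul_assoc, dyadic_mul_neighbours]

/-- If `Θ < Θ'` then `Φ'₊ = 1` on the support of `Φ₊`, so that the `+` component for `Θ` only
depends on the neighbouring `+` components for `Θ'`. -/
lemma psi_plus_mul_neighbours (χ : Cutoff) {Θ Θ' : ConeSystem d ds du} (h : Θ.Below Θ') (n : ℕ)
    (ξ : Eu d) :
    psi χ Θ (n + 2) .plus ξ * (psi χ Θ' (n + 1) .plus ξ + psi χ Θ' (n + 2) .plus ξ +
      psi χ Θ' (n + 3) .plus ξ) = psi χ Θ (n + 2) .plus ξ := by
  rcases eq_or_ne ξ 0 with rfl | hξ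
  · have : dyadic χ (n + 2) (0 : Eu d) = 0 :=
      dyadic_succ_eq_zero_of_le χ (by rw [norm_zero]; positivity)
    rw [psi, this, mul_zero, zero_mul]
  have hs : ‖ξ‖⁻¹ • ξ ∈ Metric.sphere (0 : Eu d) 1 := by
    rw [mem_sphere_zero_iff_norm, norm_smul, norm_inv, norm_norm,
      inv_mul_cancel₀ (norm_ne_zero_iff.2 hξ)]
  rcases h.mem_plus_or (‖ξ‖⁻¹ • ξ) with h1 | h1
  · simp only [psi, ConeSystem.Phi, Θ'.eq_one _ ⟨hs, h1⟩, one_mul]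
    rw [mul_assoc, dyadic_mul_neighbours]
  · simp only [psi, ConeSystem.Phi, Θ.eq_zero _ ⟨hs, h1⟩, zero_mul]

/-- The symbol `‖ξ‖^{-2N}` cut off to a neighbourhood of the shell `1 ≤ ‖ξ‖ ≤ 4`. -/
def annulus (χ : Cutoff) (N : ℕ) (ξ : Eu d) : ℝ :=
  (‖ξ‖ ^ (2 * N))⁻¹ * (χ.toFun (4⁻¹ * ‖ξ‖) - χ.toFun (2 * ‖ξ‖))

lemma contDiff_annulus (χ : Cutoff) (N : ℕ) : ContDiff ℝ ∞ (annulus χ N : Eu d → ℝ) := by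
  refine contDiff_mul_of_eq_zero_near (r := 2⁻¹) ?_ ((χ.contDiff_norm _).sub (χ.contDiff_norm _))
    (by norm_num) fun ξ h => ?_
  · intro ξ hξ
    have hξ' : ξ ≠ 0 := hξ
    exact ((((contDiffAt_norm ℝ hξ').pow _).inv
      (pow_ne_zero _ (norm_ne_zero_iff.2 hξ')))).contDiffWithinAt
  · have := norm_nonneg ξ
    rw [χ.eq_one_of_le (by positivity) (by linarith), χ.eq_one_of_le (by positivity) (by linarith),
      sub_self]

/-- The symbol `annulus` as a Schwartz function. -/
def annulusS (χ : Cutoff) (N : ℕ) : Sch d :=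
  symbol (annulus χ N) (contDiff_annulus χ N) 8 fun ξ h => by
    rw [annulus, χ.eq_zero_of_le (by linarith), χ.eq_zero_of_le (by linarith), sub_self, mul_zero]

lemma annulusS_mul_psiS_one (χ : Cutoff) (Θ : ConeSystem d ds du) (N : ℕ) (σ : Sgn) (ξ : Eu d) :
    annulusS χ N ξ * ((‖ξ‖ ^ (2 * N) : ℝ) : ℂ) * psiS χ Θ 1 σ ξ = psiS χ Θ 1 σ ξ := by
  rw [annulusS, symbol_apply, psiS_apply, psi]
  rcases le_total ‖ξ‖ (2 ^ 0) with h | h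
  · rw [dyadic_succ_eq_zero_of_le χ h]; simp
  rcases le_total (2 ^ 2) ‖ξ‖ with h' | h'
  · rw [dyadic_succ_eq_zero_of_ge χ h']; simp
  rw [pow_zero] at h
  have h3 : ‖ξ‖ ^ (2 * N) ≠ 0 := by positivity
  rw [annulus, χ.eq_one_of_le (by positivity) (by linarith), χ.eq_zero_of_le (by linarith),
    sub_zero, mul_one, ← Complex.ofReal_mul, inv_mul_cancel₀ h3, Complex.ofReal_one, one_mul]

/-- The components of index at least `1` are in the range of `Δ^N`, with a gain `2^{-2Nn}`. -/
lemma comp_succ_eq_lapPow (χ : Cutoff) (Θ : ConeSystem d ds du) (N n : ℕ) (σ : Sgn) (f : Sch d) :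
    comp χ Θ (n + 1) σ f = ((-1) ^ N * (((2 : ℝ) ^ n)⁻¹ ^ (2 * N) : ℝ) : ℂ) •
      lapPow N (convS (ker (dilate (scale n) (annulusS χ N))) (comp χ Θ (n + 1) σ f)) := by
  apply eq_of_fourier_eq
  intro ξ
  rw [FourierTransform.fourier_smul, smul_apply, fourier_lapPow, fourier_convS_ker, fourier_comp,
    ← psiS_apply, psiS_succ, dilate_apply, dilate_apply]
  set η := (scale n : ℝ) • (2 * Real.pi) • ξ with hη
  have h1 : ‖(2 * Real.pi) • ξ‖ = 2 ^ n * ‖η‖ := by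
    rw [hη, norm_smul (scale n : ℝ), coe_scale, Real.norm_of_nonneg (by positivity),
      mul_inv_cancel_left₀ (by positivity)]
  have h2 : ((2 : ℝ) ^ n)⁻¹ ^ (2 * N) * ‖(2 * Real.pi) • ξ‖ ^ (2 * N) = ‖η‖ ^ (2 * N) := by
    rw [h1, ← mul_pow, ← mul_assoc, inv_mul_cancel₀ (by positivity), one_mul]
  have h3 : ((-1 : ℂ) ^ N) * (-1) ^ N = 1 := by
    rw [← mul_pow]; simp
  conv_lhs => rw [← annulusS_mul_psiS_one χ Θ N σ η, ← h2]
  rw [smul_eq_mul]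
  push_cast
  linear_combination (-(annulusS χ N η) * psiS χ Θ 1 σ η * 𝓕 f ξ *
    ((2 : ℂ) ^ n)⁻¹ ^ (2 * N) * (‖(2 * Real.pi) • ξ‖ : ℂ) ^ (2 * N)) * h3

/-- A symbol equal to `1` on the support of `ψ_{Θ,0,σ}`. -/
def lowS (χ : Cutoff) : Sch d :=
  symbol (fun ξ => χ.toFun (2⁻¹ * ‖ξ‖)) (χ.contDiff_norm _) 4 fun ξ h =>
    χ.eq_zero_of_le (by linarith)

lemma comp_zero_eq (χ : Cutoff) (Θ : ConeSystem d ds du) (σ : Sgn) (f : Sch d) :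
    comp χ Θ 0 σ f = convS (ker (lowS χ)) (comp χ Θ 0 σ f) := by
  apply eq_of_fourier_eq
  intro ξ
  rw [fourier_convS_ker, fourier_comp, lowS, symbol_apply, psi, ← mul_assoc]
  set η := (2 * Real.pi) • ξ
  congr 1
  rcases le_total ‖η‖ 2 with h | h
  · have h1 : χ.toFun (2⁻¹ * ‖η‖) = 1 := χ.eq_one_of_le (by positivity) (by linarith)
    rw [h1]; simp
  · rw [χ.eq_zero_of_le h]; simp

end Symbols

/-! ### Pairing of test functions with the dyadic components -/

section Pairing

variable {d ds du : ℕ}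

/-- The decay at unit scale of a kernel concentrated at scale `2^{-n}`: the factor `2^{nd}` is the
height of the kernel. -/
lemma exists_ker_dilate_decay (a : Sch d) :
    ∃ A : ℝ, 0 ≤ A ∧ ∀ (n : ℕ) (z : Eu d),
      ‖ker (dilate (scale n) a) z‖ ≤ (((2 : ℝ) ^ n) ^ d * A) * ((1 + ‖z‖) ^ (d + 1))⁻¹ := by
  obtain ⟨A, hA, h⟩ := exists_decay (ker a) (d + 1)
  refine ⟨A, hA, fun n z => ?_⟩
  have hp : (1 : ℝ) ≤ 2 ^ n := one_le_pow₀ (by norm_num)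
  rw [ker_dilate, norm_mul, Complex.norm_real, coe_scale, inv_inv, inv_pow, abs_inv, inv_inv,
    abs_of_pos (by positivity), Real.norm_of_nonneg (by positivity), mul_assoc]
  gcongr
  refine (h _).trans ?_
  gcongr
  rw [norm_smul, Real.norm_of_nonneg (by positivity)]
  exact le_mul_of_one_le_left (norm_nonneg _) hp

/-- A decaying kernel turns a bound for the leaf norm into a pointwise bound. -/
lemma ConeSystem.exists_norm_convS_le (Θ : ConeSystem d ds du) :
    ∃ C : ℝ, 0 ≤ C ∧ ∀ (A B : ℝ) (k h : Sch d), 0 ≤ A → 0 ≤ B →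
      (∀ z, ‖k z‖ ≤ A * ((1 + ‖z‖) ^ (d + 1))⁻¹) → leafNorm Θ h ≤ ENNReal.ofReal B → ∀ x,
      ‖convS k h x‖ ≤ C * A * B := by
  obtain ⟨C, hC⟩ := Θ.exists_lintegral_mul_le
  refine ⟨C, C.2, fun A B k h hA hB hk hh x => ?_⟩
  have h1 : ‖convS k h x‖ₑ ≤ C * ENNReal.ofReal A * ENNReal.ofReal B := by
    rw [convS_apply]
    refine (enorm_integral_le_lintegral_enorm _).trans ?_
    simp_rw [enorm_mul]
    refine (hC A h k h.continuous.measurable hk x).trans ?_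
    gcongr
  have h2 : (C : ℝ≥0∞) * ENNReal.ofReal A * ENNReal.ofReal B = ENNReal.ofReal (C * A * B) := by
    rw [ENNReal.ofReal_mul (by positivity), ENNReal.ofReal_mul (by positivity),
      ENNReal.ofReal_coe_nnreal]
  rw [h2, ← ofReal_norm, ENNReal.ofReal_le_ofReal_iff (by positivity)] at h1
  exact h1

lemma leafNorm_comp_le_of_signedNorm_le {χ : Cutoff} {Θ : ConeSystem d ds du} {r : ℝ} {σ : Sgn}
    {f : Sch d} {B : ℝ} (h : signedNorm χ Θ r σ f ≤ ENNReal.ofReal B) (n : ℕ) :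
    leafNorm Θ (comp χ Θ n σ f) ≤ ENNReal.ofReal (2 ^ (-(r * n)) * B) := by
  have h1 := (le_iSup (fun n : ℕ => ENNReal.ofReal ((2 : ℝ) ^ (r * (n : ℝ))) *
        leafNorm Θ (component χ Θ n σ f)) n).trans h
  simp only [component_eq] at h1
  rw [Real.rpow_neg (by norm_num), ENNReal.ofReal_mul (by positivity),
    ENNReal.ofReal_inv_of_pos (by positivity), mul_comm, ← div_eq_mul_inv,
    ENNReal.le_div_iff_mul_le (Or.inl (by simp; positivity)) (Or.inl ENNReal.ofReal_ne_top),
    mul_comm]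
  exact h1

lemma norm_integral_mul_le {g F : Sch d} {S : ℝ} (h : ∀ x, ‖F x‖ ≤ S) :
    ‖∫ x, g x * F x‖ ≤ S * ∫ x, ‖g x‖ := by
  rw [← integral_const_mul]
  refine norm_integral_le_of_norm_le (g.integrable.norm.const_mul S)
    (Filter.Eventually.of_forall fun x => ?_)
  rw [norm_mul, mul_comm]
  gcongr
  exact h x

/-- The pairing of a test function with the `n`-th component decays geometrically in `n`: the
component is `Δ^N` of a function that is small for large `N`, and the powers of the Laplacian are
moved to the test function. -/
lemma exists_norm_pairing_comp_le (χ : Cutoff) (Θ : ConeSystem d ds du) {r : ℝ} {N : ℕ}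
    (hN : d + 1 - r ≤ 2 * N) :
    ∃ C : ℝ, 0 ≤ C ∧ ∀ (n : ℕ) (σ : Sgn) (f g : Sch d) (B : ℝ), 0 ≤ B →
      signedNorm χ Θ r σ f ≤ ENNReal.ofReal B →
      ‖∫ x, g x * comp χ Θ n σ f x‖ ≤
        C * (1 / 2) ^ n * B * ((∫ x, ‖g x‖) + ∫ x, ‖lapPow N g x‖) := by
  obtain ⟨C, hC, hconv⟩ := Θ.exists_norm_convS_le
  obtain ⟨A₀, hA₀, hdec₀⟩ := exists_decay (ker (lowS χ : Sch d)) (d + 1)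
  obtain ⟨A, hA, hdec⟩ := exists_ker_dilate_decay (annulusS χ N : Sch d)
  have hint : ∀ g : Sch d, 0 ≤ ∫ x, ‖g x‖ := fun g => integral_nonneg fun x => norm_nonneg _
  refine ⟨C * A₀ + C * A * 2 ^ (-r) * 2, by positivity, fun n σ f g B hB hf => ?_⟩
  have hleaf := leafNorm_comp_le_of_signedNorm_le hf
  have h0 := hint g
  have h1 := hint (lapPow N g)
  cases n with
  | zero =>
    have h2 := hleaf 0
    simp only [Nat.cast_zero, mul_zero, neg_zero, Real.rpow_zero, one_mul] at h2
    have h3 := hconv A₀ B (ker (lowS χ)) _ hA₀ hB hdec₀ h2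
    rw [← comp_zero_eq] at h3
    refine (norm_integral_mul_le h3).trans ?_
    rw [pow_zero, mul_one]
    gcongr
    · have : 0 ≤ C * A * 2 ^ (-r) * 2 := by positivity
      linarith
    · linarith
  | succ n =>
    have h2 : ∀ x, ‖convS (ker (dilate (scale n) (annulusS χ N))) (comp χ Θ (n + 1) σ f) x‖ ≤ _ :=
      hconv _ _ _ _ (by positivity) (by positivity) (hdec n) (hleaf (n + 1))
    rw [comp_succ_eq_lapPow χ Θ N n σ f]
    simp only [smul_apply, smul_eq_mul]
    have h3 : ∀ c : ℂ, ∀ F : Sch d, ∫ x, g x * (c * lapPow N F x) =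
        c * ∫ x, lapPow N g x * F x := by
      intro c F
      rw [← integral_mul_lapPow, ← integral_const_mul]
      congr 1
      funext x
      ring
    rw [h3, norm_mul]
    have h4 : ‖((-1) ^ N * (((2 : ℝ) ^ n)⁻¹ ^ (2 * N) : ℝ) : ℂ)‖ = ((2 : ℝ) ^ n)⁻¹ ^ (2 * N) := by
      rw [norm_mul, norm_pow, norm_neg, norm_one, one_pow, one_mul, Complex.norm_real,
        Real.norm_of_nonneg (by positivity)]
    rw [h4]
    have h5 : ((2 : ℝ) ^ n)⁻¹ ^ (2 * N) * (((2 : ℝ) ^ n) ^ d * 2 ^ (-(r * (n + 1 : ℕ)))) ≤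
        2 ^ (-r) * 2 * (1 / 2) ^ (n + 1) := by
      have e1 : ((2 : ℝ) ^ n)⁻¹ ^ (2 * N) = (2 : ℝ) ^ (-(n * (2 * N) : ℝ)) := by
        rw [inv_pow, ← pow_mul, Real.rpow_neg (by norm_num)]
        congr 1
        exact_mod_cast (Real.rpow_natCast 2 (n * (2 * N))).symm
      have e2 : ((2 : ℝ) ^ n) ^ d = (2 : ℝ) ^ (n * d : ℝ) := by
        rw [← pow_mul]
        exact_mod_cast (Real.rpow_natCast 2 (n * d)).symm
      have e3 : (2 : ℝ) * (1 / 2) ^ (n + 1) = (2 : ℝ) ^ (-(n : ℝ)) := by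
        rw [Real.rpow_neg (by norm_num), Real.rpow_natCast, pow_succ, one_div, inv_pow]
        ring
      rw [e1, e2, mul_assoc, e3, ← Real.rpow_add (by norm_num), ← Real.rpow_add (by norm_num),
        ← Real.rpow_add (by norm_num)]
      refine Real.rpow_le_rpow_of_exponent_le (by norm_num) ?_
      push_cast
      have hn : (0 : ℝ) ≤ n := Nat.cast_nonneg n
      nlinarith
    calc ((2 : ℝ) ^ n)⁻¹ ^ (2 * N) * ‖∫ x, lapPow N g x *
          convS (ker (dilate (scale n) (annulusS χ N))) (comp χ Θ (n + 1) σ f) x‖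
        ≤ ((2 : ℝ) ^ n)⁻¹ ^ (2 * N) * ((C * (((2 : ℝ) ^ n) ^ d * A) *
            (2 ^ (-(r * (n + 1 : ℕ))) * B)) * ∫ x, ‖lapPow N g x‖) := by
          gcongr
          exact norm_integral_mul_le h2
      _ = (C * A * (((2 : ℝ) ^ n)⁻¹ ^ (2 * N) * (((2 : ℝ) ^ n) ^ d *
            2 ^ (-(r * (n + 1 : ℕ)))))) * B * ∫ x, ‖lapPow N g x‖ := by ring
      _ ≤ (C * A * (2 ^ (-r) * 2 * (1 / 2) ^ (n + 1))) * B * ∫ x, ‖lapPow N g x‖ := by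
          gcongr
      _ = (C * A * 2 ^ (-r) * 2) * (1 / 2) ^ (n + 1) * B * ∫ x, ‖lapPow N g x‖ := by ring
      _ ≤ _ := by
          gcongr
          · have : 0 ≤ C * A₀ := by positivity
            linarith
          · linarith

lemma integral_mul_comp (χ : Cutoff) (Θ : ConeSystem d ds du) (n : ℕ) (σ : Sgn) (f g : Sch d) :
    ∫ x, g x * comp χ Θ n σ f x =
      ∫ ξ, 𝓕⁻ g ξ * ((psi χ Θ n σ ((2 * Real.pi) • ξ) : ℂ) * 𝓕 f ξ) := by
  conv_lhs => rw [← FourierTransform.fourierInv_fourier_eq (E := Sch d) (F := Sch d)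
    (comp χ Θ n σ f)]
  rw [integral_mul_fourierInv]
  simp_rw [fourier_comp]

/-- Convergence of the Littlewood--Paley decomposition, tested against Schwartz functions. -/
lemma tendsto_sum_pairing (χ : Cutoff) (Θ : ConeSystem d ds du) (f g : Sch d) :
    Filter.Tendsto (fun M : ℕ => ∑ m ∈ Finset.range (M + 1),
      ((∫ x, g x * comp χ Θ m .plus f x) + ∫ x, g x * comp χ Θ m .minus f x))
      Filter.atTop (nhds (∫ x, g x * f x)) := by
  have hF : ∫ x, g x * f x = ∫ ξ, 𝓕⁻ g ξ * 𝓕 f ξ := by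
    conv_lhs => rw [← FourierTransform.fourierInv_fourier_eq (E := Sch d) (F := Sch d) f]
    rw [integral_mul_fourierInv]
  have hi : ∀ m σ, Integrable fun ξ : Eu d =>
      𝓕⁻ g ξ * ((psi χ Θ m σ ((2 * Real.pi) • ξ) : ℂ) * 𝓕 f ξ) := by
    intro m σ
    simp_rw [← fourier_comp]
    exact (mulS (𝓕⁻ g) (𝓕 (comp χ Θ m σ f))).integrable.congr
      (Filter.Eventually.of_forall fun x => mulS_apply _ _ x)
  have hS : ∀ M : ℕ, ∑ m ∈ Finset.range (M + 1),
      ((∫ x, g x * comp χ Θ m .plus f x) + ∫ x, g x * comp χ Θ m .minus f x) =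
      ∫ ξ, (χ.toFun ((2 ^ M)⁻¹ * ‖(2 * Real.pi) • ξ‖) : ℂ) * (𝓕⁻ g ξ * 𝓕 f ξ) := by
    intro M
    simp_rw [integral_mul_comp]
    rw [Finset.sum_congr rfl fun m _ => (integral_add (hi m .plus) (hi m .minus)).symm]
    refine (integral_finsetSum (Finset.range (M + 1))
      fun m _ => (hi m .plus).add (hi m .minus)).symm.trans ?_
    simp only [Pi.add_apply]
    congr 1
    funext ξ
    rw [← sum_dyadic]
    push_cast
    rw [Finset.sum_mul]
    refine Finset.sum_congr rfl fun m _ => ?_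
    rw [← psi_plus_add_psi_minus χ Θ]
    push_cast
    ring
  simp_rw [hS]
  rw [hF]
  have hI : Integrable fun ξ => 𝓕⁻ g ξ * 𝓕 f ξ := (mulS (𝓕⁻ g) (𝓕 f)).integrable.congr
      (Filter.Eventually.of_forall fun x => mulS_apply _ _ x)
  have hcont : ∀ M : ℕ, Continuous fun ξ : Eu d =>
      (χ.toFun ((2 ^ M)⁻¹ * ‖(2 * Real.pi) • ξ‖) : ℂ) := fun M =>
    Complex.continuous_ofReal.comp (χ.smooth.continuous.comp (by fun_prop))
  refine tendsto_integral_of_dominated_convergence (fun ξ => ‖𝓕⁻ g ξ * 𝓕 f ξ‖)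
    (fun M => (hcont M).aestronglyMeasurable.mul hI.aestronglyMeasurable) hI.norm
    (fun M => Filter.Eventually.of_forall fun ξ => ?_) (Filter.Eventually.of_forall fun ξ => ?_)
  · have h1 := χ.mem_Icc ((2 ^ M)⁻¹ * ‖(2 * Real.pi) • ξ‖)
    rw [norm_mul, Complex.norm_real, Real.norm_of_nonneg h1.1]
    exact mul_le_of_le_one_left (norm_nonneg _) h1.2
  · refine tendsto_const_nhds.congr' ?_
    obtain ⟨M₀, hM₀⟩ := pow_unbounded_of_one_lt ‖(2 * Real.pi) • ξ‖ (one_lt_two (α := ℝ))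
    filter_upwards [Filter.eventually_ge_atTop M₀] with M hM
    have h1 : χ.toFun ((2 ^ M)⁻¹ * ‖(2 * Real.pi) • ξ‖) = 1 := by
      refine χ.eq_one_of_le (by positivity) ?_
      rw [inv_mul_eq_div, div_le_one (by positivity)]
      exact hM₀.le.trans (pow_le_pow_right₀ (by norm_num) hM)
    rw [h1, Complex.ofReal_one, one_mul]

/-- Schwartz functions are controlled by the anisotropic norm in the sense of distributions. -/
lemma exists_norm_integral_mul_le (χ : Cutoff) (Θ : ConeSystem d ds du) (t s : ℝ) :
    ∃ (C : ℝ) (N : ℕ), 0 ≤ C ∧ ∀ (f g : Sch d) (B : ℝ), 0 ≤ B →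
      localNorm χ Θ t s f ≤ ENNReal.ofReal B →
      ‖∫ x, g x * f x‖ ≤ C * B * ((∫ x, ‖g x‖) + ∫ x, ‖lapPow N g x‖) := by
  -- `Δ^N` gains `2^{-2Nn}`, against the losses `2^{nd}` of the kernel and `2^{n max(|t|, |s|)}` of
  -- the norm.
  obtain ⟨N, hN⟩ := exists_nat_ge (d + 1 + |t| + |s|)
  have hN0 : (0 : ℝ) ≤ N := Nat.cast_nonneg N
  have := neg_abs_le t
  have := neg_abs_le s
  have := abs_nonneg t
  have := abs_nonneg s
  obtain ⟨C₁, hC₁, h₁⟩ := exists_norm_pairing_comp_le χ Θ (r := t) (N := N) (by linarith)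
  obtain ⟨C₂, hC₂, h₂⟩ := exists_norm_pairing_comp_le χ Θ (r := s) (N := N) (by linarith)
  refine ⟨2 * (C₁ + C₂), N, by positivity, fun f g B hB hf => ?_⟩
  have hf₁ := (le_max_left _ _).trans hf
  have hf₂ := (le_max_right _ _).trans hf
  set J := (∫ x, ‖g x‖) + ∫ x, ‖lapPow N g x‖ with hJ
  have hJ0 : 0 ≤ J := add_nonneg (integral_nonneg fun _ => norm_nonneg _)
    (integral_nonneg fun _ => norm_nonneg _)
  refine le_of_tendsto (tendsto_sum_pairing χ Θ f g).norm (Filter.Eventually.of_forall fun M => ?_)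
  calc _ ≤ ∑ m ∈ Finset.range (M + 1), (1 / 2 : ℝ) ^ m * ((C₁ + C₂) * B * J) := by
        refine norm_sum_le_of_le _ fun m _ => (norm_add_le _ _).trans ?_
        refine (add_le_add (h₁ m .plus f g B hB hf₁) (h₂ m .minus f g B hB hf₂)).trans
          (le_of_eq ?_)
        ring
    _ = (∑ m ∈ Finset.range (M + 1), (1 / 2 : ℝ) ^ m) * ((C₁ + C₂) * B * J) :=
        (Finset.sum_mul _ _ _).symm
    _ ≤ 2 * ((C₁ + C₂) * B * J) := by
        gcongr
        exact sum_geometric_two_le _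
    _ = _ := by ring

end Pairing

/-! ### Pointwise bounds for smoothed functions of bounded support -/

section Localization

variable {d ds du : ℕ}

/-- The function `y ↦ k (x - y)`. -/
def reflectAt (k : Sch d) (x : Eu d) : Sch d :=
  SchwartzMap.compSubConstCLM ℂ x
    (SchwartzMap.compCLMOfContinuousLinearEquiv ℂ (ContinuousLinearEquiv.neg ℝ) k)

@[simp] lemma reflectAt_apply (k : Sch d) (x y : Eu d) : reflectAt k x y = k (x - y) := by
  simp [reflectAt]

/-- Multiplying by a fixed Schwartz function `η` localises near the origin, where `y ↦ k (x - y)` is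
small with all derivatives when `x` is large. -/
lemma exists_seminorm_mul_reflectAt_le (η k : Sch d) (j l N : ℕ) :
    ∃ C : ℝ, 0 ≤ C ∧ ∀ x, SchwartzMap.seminorm ℂ j l (mulS η (reflectAt k x)) ≤
      C * ((1 + ‖x‖) ^ N)⁻¹ := by
  set k' : Sch d :=
    SchwartzMap.compCLMOfContinuousLinearEquiv ℂ (ContinuousLinearEquiv.neg ℝ) k with hk'
  set P := 2 ^ (j + N) * ((Finset.Iic (j + N, l)).sup fun m => SchwartzMap.seminorm ℝ m.1 m.2) η
  set Q := 2 ^ N * ((Finset.Iic (N, l)).sup fun m => SchwartzMap.seminorm ℝ m.1 m.2) k'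
  have hP : 0 ≤ P := by positivity
  have hQ : 0 ≤ Q := by positivity
  have h1 : ∀ i ≤ l, ∀ y, (1 + ‖y‖) ^ (j + N) * ‖iteratedFDeriv ℝ i η y‖ ≤ P := fun i hi y =>
    SchwartzMap.one_add_le_sup_seminorm_apply (𝕜 := ℝ) (m := (j + N, l)) le_rfl hi η y
  have h2 : ∀ i ≤ l, ∀ y, (1 + ‖y‖) ^ N * ‖iteratedFDeriv ℝ i k' y‖ ≤ Q := fun i hi y =>
    SchwartzMap.one_add_le_sup_seminorm_apply (𝕜 := ℝ) (m := (N, l)) le_rfl hi k' y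
  refine ⟨∑ i ∈ Finset.range (l + 1), (l.choose i : ℝ) * (P * Q), by positivity, fun x => ?_⟩
  refine SchwartzMap.seminorm_le_bound ℂ j l _ (by positivity) fun y => ?_
  have hmul : ‖iteratedFDeriv ℝ l (mulS η (reflectAt k x)) y‖ ≤
      ∑ i ∈ Finset.range (l + 1), (l.choose i : ℝ) * ‖iteratedFDeriv ℝ i η y‖ *
        ‖iteratedFDeriv ℝ (l - i) k' (y - x)‖ := by
    have h3 : (mulS η (reflectAt k x) : Eu d → ℂ) = fun y => η y * reflectAt k x y := by
      funext y; simp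
    have h4 : (reflectAt k x : Eu d → ℂ) = fun y => k' (y - x) := rfl
    rw [h3]
    refine (norm_iteratedFDeriv_mul_le (η.smooth ⊤) ((reflectAt k x).smooth ⊤) y
      (n := l) (by exact_mod_cast le_top)).trans (le_of_eq ?_)
    refine Finset.sum_congr rfl fun i _ => ?_
    rw [h4, iteratedFDeriv_comp_sub]
  rw [← div_eq_mul_inv, le_div_iff₀ (by positivity)]
  have htri : (1 + ‖x‖) ^ N ≤ (1 + ‖y‖) ^ N * (1 + ‖y - x‖) ^ N := by
    rw [← mul_pow]
    gcongr
    have : ‖x‖ ≤ ‖y‖ + ‖y - x‖ := by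
      have := norm_sub_le y (y - x)
      rwa [sub_sub_cancel] at this
    nlinarith [norm_nonneg y, norm_nonneg (y - x)]
  calc ‖y‖ ^ j * ‖iteratedFDeriv ℝ l (mulS η (reflectAt k x)) y‖ * (1 + ‖x‖) ^ N
      ≤ (1 + ‖y‖) ^ j * (∑ i ∈ Finset.range (l + 1), (l.choose i : ℝ) *
          ‖iteratedFDeriv ℝ i η y‖ * ‖iteratedFDeriv ℝ (l - i) k' (y - x)‖) *
          ((1 + ‖y‖) ^ N * (1 + ‖y - x‖) ^ N) := by
        gcongr
        linarith
    _ = ∑ i ∈ Finset.range (l + 1), (l.choose i : ℝ) *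
          (((1 + ‖y‖) ^ (j + N) * ‖iteratedFDeriv ℝ i η y‖) *
          ((1 + ‖y - x‖) ^ N * ‖iteratedFDeriv ℝ (l - i) k' (y - x)‖)) := by
        rw [Finset.mul_sum, Finset.sum_mul]
        refine Finset.sum_congr rfl fun i _ => ?_
        ring
    _ ≤ _ := by
        gcongr with i hi
        · exact h1 i (by simpa [Nat.lt_succ_iff] using hi) y
        · exact h2 (l - i) (Nat.sub_le _ _) (y - x)

lemma exists_integral_mul_reflectAt_le (T : Sch d →L[ℂ] Sch d) (η k : Sch d) (N : ℕ) :
    ∃ C : ℝ, 0 ≤ C ∧ ∀ x, ∫ y, ‖T (mulS η (reflectAt k x)) y‖ ≤ C * ((1 + ‖x‖) ^ N)⁻¹ := by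
  let S : Sch d →L[ℂ] Lp ℂ 1 (volume : Measure (Eu d)) :=
    (SchwartzMap.toLpCLM ℂ ℂ 1 volume).comp T
  let q : Seminorm ℂ (Sch d) := (normSeminorm ℂ (Lp ℂ 1 (volume : Measure (Eu d)))).comp
    S.toLinearMap
  have hq : Continuous q := continuous_norm.comp S.continuous
  obtain ⟨F, C, -, hF⟩ := Seminorm.bound_of_continuous (schwartz_withSeminorms ℂ (Eu d) ℂ) q hq
  choose D hD0 hD using fun m : ℕ × ℕ => exists_seminorm_mul_reflectAt_le η k m.1 m.2 N
  refine ⟨C * ∑ m ∈ F, D m, by have := Finset.sum_nonneg fun m (_ : m ∈ F) => hD0 m; positivity,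
    fun x => ?_⟩
  have h1 : ∫ y, ‖T (mulS η (reflectAt k x)) y‖ = q (mulS η (reflectAt k x)) := by
    rw [← SchwartzMap.norm_toLp_one]
    rfl
  rw [h1, mul_assoc]
  refine (hF _).trans ?_
  rw [smul_apply, NNReal.smul_def, smul_eq_mul]
  gcongr
  refine Seminorm.finset_sup_apply_le
    (mul_nonneg (Finset.sum_nonneg fun m _ => hD0 m) (by positivity)) fun m hm => ?_
  refine (hD m x).trans ?_
  gcongr
  exact Finset.single_le_sum (fun m _ => hD0 m) hm

/-- For functions supported in a fixed ball, the anisotropic norm controls every convolution with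
a Schwartz function, with rapid decay at infinity. -/
lemma exists_norm_convS_le_of_localNorm_le (χ : Cutoff) (Θ : ConeSystem d ds du) (t s : ℝ) {R : ℝ}
    (hR : 0 < R) (k : Sch d) (N : ℕ) :
    ∃ C : ℝ, 0 ≤ C ∧ ∀ f : Sch d, (∀ y, R ≤ ‖y‖ → f y = 0) → ∀ B : ℝ, 0 ≤ B →
      localNorm χ Θ t s f ≤ ENNReal.ofReal B → ∀ x,
      ‖convS k f x‖ ≤ C * ((1 + ‖x‖) ^ N)⁻¹ * B := by
  -- As `f` is supported where `η = 1`, the value `(k * f)(x)` is the pairing of `f` with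
  -- `η k(x - ·)`, whose Schwartz seminorms decay in `x`.
  obtain ⟨C, L, hC, h⟩ := exists_norm_integral_mul_le χ Θ t s
  let η : Sch d := symbol (fun ξ => χ.toFun (R⁻¹ * ‖ξ‖)) (χ.contDiff_norm _) (2 * R) fun ξ hξ =>
    χ.eq_zero_of_le (by rwa [inv_mul_eq_div, le_div_iff₀ hR])
  obtain ⟨C₁, hC₁, h₁⟩ := exists_integral_mul_reflectAt_le (ContinuousLinearMap.id ℂ _) η k N
  obtain ⟨C₂, hC₂, h₂⟩ := exists_integral_mul_reflectAt_le (lapPow L) η k N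
  refine ⟨C * (C₁ + C₂), by positivity, fun f hf B hB hfB x => ?_⟩
  have h3 : convS k f x = ∫ y, mulS η (reflectAt k x) y * f y := by
    rw [convS_apply]
    congr 1
    funext y
    rw [mulS_apply, reflectAt_apply]
    rcases le_total R ‖y‖ with hy | hy
    · rw [hf y hy, mul_zero, mul_zero]
    · have : η y = 1 := by
        simp only [η, symbol_apply]
        rw [χ.eq_one_of_le (by positivity), Complex.ofReal_one]
        rwa [inv_mul_eq_div, div_le_one hR]
      rw [this, one_mul]
  rw [h3]
  refine (h f _ B hB hfB).trans ?_
  calc C * B * ((∫ y, ‖mulS η (reflectAt k x) y‖) + ∫ y, ‖lapPow L (mulS η (reflectAt k x)) y‖)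
      ≤ C * B * (C₁ * ((1 + ‖x‖) ^ N)⁻¹ + C₂ * ((1 + ‖x‖) ^ N)⁻¹) := by
        gcongr
        · exact h₁ x
        · exact h₂ x
    _ = _ := by ring

end Localization

/-! ### Finiteness of the norm on Schwartz functions -/

section Finiteness

variable {d ds du : ℕ}

lemma leafNorm_smul (Θ : ConeSystem d ds du) (c : ℂ) (f : Eu d → ℂ) :
    leafNorm Θ (c • f) = ‖c‖ₑ * leafNorm Θ f := by
  simp only [leafNorm, ENNReal.mul_iSup]
  refine iSup_congr fun Γ => iSup_congr fun _ => ?_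
  rw [← lintegral_const_mul' _ _ enorm_ne_top]
  simp [enorm_mul]

lemma leafNorm_add_le (Θ : ConeSystem d ds du) (f g : Sch d) :
    leafNorm Θ (f + g : Sch d) ≤ leafNorm Θ f + leafNorm Θ g := by
  refine iSup₂_le fun Γ hΓ => ?_
  refine le_trans ?_ (add_le_add
    (le_iSup₂ (f := fun (Γ : Set (Eu d)) (_ : Γ ∈ Θ.leaves) =>
      ∫⁻ x in Γ, ‖f x‖ₑ ∂(Measure.euclideanHausdorffMeasure du)) Γ hΓ)
    (le_iSup₂ (f := fun (Γ : Set (Eu d)) (_ : Γ ∈ Θ.leaves) =>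
      ∫⁻ x in Γ, ‖g x‖ₑ ∂(Measure.euclideanHausdorffMeasure du)) Γ hΓ))
  rw [← lintegral_add_left f.continuous.enorm.measurable]
  exact lintegral_mono fun x => enorm_add_le _ _

lemma leafNorm_lt_top (Θ : ConeSystem d ds du) (f : Sch d) : leafNorm Θ f < ⊤ := by
  obtain ⟨C, hC⟩ := Θ.exists_leafNorm_le_of_decay
  obtain ⟨A, -, hA⟩ := exists_decay f (du + 1)
  exact (hC A f hA).trans_lt (ENNReal.mul_lt_top ENNReal.coe_lt_top ENNReal.ofReal_lt_top)

lemma lintegral_enorm_lt_top (k : Sch d) : ∫⁻ z, ‖k z‖ₑ < ⊤ := k.integrable.2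

/-- The gain `2^{-2Nn}` of a component of a smooth function, in terms of `Δ^N f`. -/
lemma comp_succ_eq_smul_convS_lapPow (χ : Cutoff) (Θ : ConeSystem d ds du) (N n : ℕ) (σ : Sgn)
    (f : Sch d) :
    comp χ Θ (n + 1) σ f = ((-1) ^ N * (((2 : ℝ) ^ n)⁻¹ ^ (2 * N) : ℝ) : ℂ) •
      convS (ker (dilate (scale n) (mulS (annulusS χ N) (psiS χ Θ 1 σ)))) (lapPow N f) := by
  rw [comp_succ_eq_lapPow χ Θ N n σ f]
  congr 1
  apply eq_of_fourier_eq
  intro ξ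
  rw [fourier_lapPow, fourier_convS_ker, fourier_convS_ker, fourier_lapPow, fourier_comp,
    ← psiS_apply, psiS_succ, dilate_apply, dilate_apply, dilate_apply, mulS_apply]
  ring

lemma signedNorm_lt_top (χ : Cutoff) (Θ : ConeSystem d ds du) (r : ℝ) (σ : Sgn) (f : Sch d) :
    signedNorm χ Θ r σ f < ⊤ := by
  obtain ⟨N, hN⟩ := exists_nat_ge r
  set K := leafNorm Θ (comp χ Θ 0 σ f)
  set L := (∫⁻ z, ‖ker (mulS (annulusS χ N) (psiS χ Θ 1 σ)) z‖ₑ) * leafNorm Θ (lapPow N f)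
  have hK : K < ⊤ := leafNorm_lt_top Θ _
  have hL : L < ⊤ := ENNReal.mul_lt_top (lintegral_enorm_lt_top _) (leafNorm_lt_top Θ _)
  refine lt_of_le_of_lt (b := K + ENNReal.ofReal (2 ^ r) * L) (iSup_le fun n => ?_)
    (ENNReal.add_lt_top.2 ⟨hK, ENNReal.mul_lt_top ENNReal.ofReal_lt_top hL⟩)
  rw [component_eq]
  cases n with
  | zero => simp [K]
  | succ n =>
    refine le_trans ?_ le_add_self
    rw [comp_succ_eq_smul_convS_lapPow χ Θ N, FunLike.coe_smul, leafNorm_smul]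
    have h1 : ‖((-1) ^ N * (((2 : ℝ) ^ n)⁻¹ ^ (2 * N) : ℝ) : ℂ)‖ₑ =
        ENNReal.ofReal (((2 : ℝ) ^ n)⁻¹ ^ (2 * N)) := by
      rw [← ofReal_norm, norm_mul, norm_pow, norm_neg, norm_one, one_pow, one_mul,
        Complex.norm_real, Real.norm_of_nonneg (by positivity)]
    rw [h1, ← mul_assoc, ← ENNReal.ofReal_mul (by positivity)]
    gcongr
    · have e1 : ((2 : ℝ) ^ n)⁻¹ ^ (2 * N) = (2 : ℝ) ^ (-(n * (2 * N) : ℝ)) := by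
        rw [inv_pow, ← pow_mul, Real.rpow_neg (by norm_num)]
        congr 1
        exact_mod_cast (Real.rpow_natCast 2 (n * (2 * N))).symm
      rw [e1, ← Real.rpow_add (by norm_num)]
      refine Real.rpow_le_rpow_of_exponent_le (by norm_num) ?_
      push_cast
      have hn : (0 : ℝ) ≤ n := Nat.cast_nonneg n
      have hN' : (0 : ℝ) ≤ N := Nat.cast_nonneg N
      nlinarith
    · refine (Θ.leafNorm_convS_le _ _).trans ?_
      rw [lintegral_ker_dilate]

/-- The anisotropic norm of a Schwartz function is finite. -/
lemma localNorm_lt_top (χ : Cutoff) (Θ : ConeSystem d ds du) (t s : ℝ) (f : Sch d) :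
    localNorm χ Θ t s f < ⊤ :=
  max_lt (signedNorm_lt_top χ Θ t .plus f) (signedNorm_lt_top χ Θ s .minus f)

end Finiteness

/-! ### Comparison of two anisotropic norms -/

section Comparison

variable {d ds du : ℕ}

/-- Smoothing operators map bounded sets of functions of bounded support to equicontinuous sets. -/
lemma exists_lipschitz_convS (χ : Cutoff) (Θ : ConeSystem d ds du) (t s : ℝ) {R : ℝ}
    (hR : 0 < R) (k : Sch d) :
    ∃ C : ℝ, 0 ≤ C ∧ ∀ f : Sch d, (∀ y, R ≤ ‖y‖ → f y = 0) → ∀ B : ℝ, 0 ≤ B →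
      localNorm χ Θ t s f ≤ ENNReal.ofReal B → ∀ x y,
      ‖convS k f x - convS k f y‖ ≤ C * B * ‖x - y‖ := by
  choose C hC h using fun j : Fin d => exists_norm_convS_le_of_localNorm_le χ Θ t s hR
    (∂_{(EuclideanSpace.basisFun (Fin d) ℝ j : Eu d)} k) 0
  have hCs : 0 ≤ ∑ j, C j := Finset.sum_nonneg fun j _ => hC j
  refine ⟨∑ j, C j, hCs, fun f hf B hB hfB x y => ?_⟩
  refine Convex.norm_image_sub_le_of_norm_fderiv_le (𝕜 := ℝ) (s := univ)
    (fun z _ => (convS k f).differentiableAt) (fun z _ => ?_) convex_univ (mem_univ y) (mem_univ x)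
  refine ContinuousLinearMap.opNorm_le_bound _ (by positivity) fun v => ?_
  have hv : v = ∑ j, v j • EuclideanSpace.basisFun (Fin d) ℝ j := by
    conv_lhs => rw [← (EuclideanSpace.basisFun (Fin d) ℝ).sum_repr v]
    simp
  conv_lhs => rw [hv, map_sum]
  rw [Finset.sum_mul, Finset.sum_mul]
  refine norm_sum_le_of_le _ fun j _ => ?_
  rw [map_smul, fderiv_convS, norm_smul, mul_comm]
  have h1 := h j f hf B hB hfB z
  rw [pow_zero, inv_one, mul_one] at h1
  have h2 : ‖v j‖ ≤ ‖v‖ := PiLp.norm_apply_le v j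
  have := hC j
  gcongr

/-- On functions of bounded support, smoothing operators are bounded from any anisotropic norm to
any leaf norm. -/
lemma exists_leafNorm_convS_le (χ : Cutoff) (Θ Θ₁ : ConeSystem d ds du) (t s : ℝ) {R : ℝ}
    (hR : 0 < R) (k : Sch d) :
    ∃ C : ℝ, 0 ≤ C ∧ ∀ f : Sch d, (∀ y, R ≤ ‖y‖ → f y = 0) → ∀ B : ℝ, 0 ≤ B →
      localNorm χ Θ t s f ≤ ENNReal.ofReal B →
      leafNorm Θ₁ (convS k f) ≤ ENNReal.ofReal (C * B) := by
  obtain ⟨C₁, h₁⟩ := Θ₁.exists_leafNorm_le_of_decay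
  obtain ⟨C₂, hC₂, h₂⟩ := exists_norm_convS_le_of_localNorm_le χ Θ t s hR k (du + 1)
  refine ⟨C₁ * C₂, by positivity, fun f hf B hB hfB => ?_⟩
  refine (h₁ (C₂ * B) _ fun x => (h₂ f hf B hB hfB x).trans (le_of_eq (by ring))).trans ?_
  rw [mul_assoc, ENNReal.ofReal_mul (p := (C₁ : ℝ)) C₁.2, ENNReal.ofReal_coe_nnreal]

/-- Compactness of a smoothing operator on functions of bounded support, in quantitative form: up
to an arbitrarily small error, finitely many point values control the leaf norm. Outside a large
ball this is rapid decay, inside it is equicontinuity. -/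
lemma exists_leafNorm_convS_le_finset (χ : Cutoff) (Θ Θ₁ : ConeSystem d ds du) (t s : ℝ) {R : ℝ}
    (hR : 0 < R) (k : Sch d) {ε : ℝ} (hε : 0 < ε) :
    ∃ (X : Finset (Eu d)) (C : ℝ), 0 ≤ C ∧ ∀ f : Sch d, (∀ y, R ≤ ‖y‖ → f y = 0) →
      ∀ B : ℝ, 0 ≤ B → localNorm χ Θ t s f ≤ ENNReal.ofReal B →
      leafNorm Θ₁ (convS k f) ≤ ENNReal.ofReal (ε * B + C * ∑ x ∈ X, ‖convS k f x‖) := by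
  obtain ⟨C₁, h₁⟩ := Θ₁.exists_leafNorm_le_of_decay
  obtain ⟨C₂, hC₂, h₂⟩ := exists_norm_convS_le_of_localNorm_le χ Θ t s hR k (du + 2)
  obtain ⟨L, hL, hLip⟩ := exists_lipschitz_convS χ Θ t s hR k
  have hC₁ : (0 : ℝ) ≤ C₁ := C₁.2
  -- Outside the ball of radius `ρ` the decay of order `du + 2` leaves a factor `(1 + ρ)⁻¹` over the
  -- decay of order `du + 1` that `h₁` needs; `Q` compares with that decay inside the ball, and `δ`
  -- is the mesh of the net `X`.
  set ρ := 2 * C₁ * C₂ / ε with hρ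
  have hρ0 : 0 ≤ ρ := by positivity
  set Q := (1 + ρ) ^ (du + 1) with hQ
  have hQ0 : 0 < Q := by positivity
  set δ := ε / (2 * (C₁ * Q * L + 1)) with hδ
  have hδ0 : 0 < δ := by positivity
  obtain ⟨X, -, hXf, hX⟩ :=
    (isCompact_closedBall (0 : Eu d) ρ).totallyBounded.exists_subset
      (Metric.dist_mem_uniformity hδ0)
  lift X to Finset (Eu d) using hXf
  refine ⟨X, C₁ * Q, by positivity, fun f hf B hB hfB => ?_⟩
  set S := ∑ x ∈ X, ‖convS k f x‖ with hS
  have hS0 : 0 ≤ S := Finset.sum_nonneg fun _ _ => norm_nonneg _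
  have hdec := h₂ f hf B hB hfB
  have hA : ∀ x, ‖convS k f x‖ ≤
      (C₂ * B * (1 + ρ)⁻¹ + Q * (L * B * δ + S)) * ((1 + ‖x‖) ^ (du + 1))⁻¹ := by
    intro x
    rcases le_total ‖x‖ ρ with hx | hx
    · have hx' : x ∈ ⋃ y ∈ (X : Set (Eu d)), {x | (x, y) ∈ {p : Eu d × Eu d | dist p.1 p.2 < δ}} :=
        hX (by simpa using hx)
      simp only [mem_iUnion, mem_ofPred_eq, Finset.mem_coe, exists_prop] at hx'
      obtain ⟨y, hy, hxy⟩ := hx'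
      have h3 : ‖convS k f x‖ ≤ L * B * δ + S := by
        have h4 := hLip f hf B hB hfB x y
        have h5 : ‖convS k f y‖ ≤ S :=
          Finset.single_le_sum (f := fun y => ‖convS k f y‖) (fun _ _ => norm_nonneg _) hy
        have h6 : L * B * ‖x - y‖ ≤ L * B * δ := by
          rw [dist_eq_norm] at hxy
          gcongr
        have h7 := norm_sub_norm_le (convS k f x) (convS k f y)
        linarith
      have h8 : 1 ≤ Q * ((1 + ‖x‖) ^ (du + 1))⁻¹ := by
        rw [← div_eq_mul_inv, one_le_div (by positivity), hQ]
        gcongr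
      have h9 : 0 ≤ L * B * δ + S := by positivity
      calc ‖convS k f x‖ ≤ 0 + (L * B * δ + S) * 1 := by linarith
        _ ≤ C₂ * B * (1 + ρ)⁻¹ * ((1 + ‖x‖) ^ (du + 1))⁻¹ +
            (L * B * δ + S) * (Q * ((1 + ‖x‖) ^ (du + 1))⁻¹) := by
          gcongr
          positivity
        _ = _ := by ring
    · have h3 : C₂ * ((1 + ‖x‖) ^ (du + 2))⁻¹ * B ≤
          C₂ * B * (1 + ρ)⁻¹ * ((1 + ‖x‖) ^ (du + 1))⁻¹ := by
        rw [pow_succ _ (du + 1), mul_inv]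
        calc C₂ * (((1 + ‖x‖) ^ (du + 1))⁻¹ * (1 + ‖x‖)⁻¹) * B
            = C₂ * B * (1 + ‖x‖)⁻¹ * ((1 + ‖x‖) ^ (du + 1))⁻¹ := by ring
          _ ≤ _ := by gcongr
      have h4 : 0 ≤ Q * (L * B * δ + S) * ((1 + ‖x‖) ^ (du + 1))⁻¹ := by positivity
      rw [add_mul]
      linarith [hdec x]
  refine (h₁ _ _ hA).trans ?_
  rw [← ENNReal.ofReal_coe_nnreal, ← ENNReal.ofReal_mul hC₁]
  refine ENNReal.ofReal_le_ofReal ?_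
  have e1 : C₁ * (C₂ * (1 + ρ)⁻¹) ≤ ε / 2 := by
    rw [← mul_assoc, ← div_eq_mul_inv, div_le_iff₀ (by positivity)]
    have : ε / 2 * ρ = C₁ * C₂ := by rw [hρ]; field_simp
    linarith
  have e2 : C₁ * Q * L * δ ≤ ε / 2 := by
    have h3 : (C₁ * Q * L + 1) * δ = ε / 2 := by
      rw [hδ]; field_simp
    linarith
  calc (C₁ : ℝ) * (C₂ * B * (1 + ρ)⁻¹ + Q * (L * B * δ + S))
      = C₁ * (C₂ * (1 + ρ)⁻¹) * B + C₁ * Q * L * δ * B + C₁ * Q * S := by ring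
    _ ≤ ε / 2 * B + ε / 2 * B + C₁ * Q * S := by gcongr
    _ = _ := by ring

/-- A component of `f` only depends on the image `g` of `f` under a Fourier multiplier `m` that is
`1` on the support of the symbol. -/
lemma comp_eq_convS_of_mul_eq {χ : Cutoff} {Θ : ConeSystem d ds du} {n : ℕ} {σ : Sgn}
    {f g : Sch d} {m : Eu d → ℝ} (hg : ∀ ξ, 𝓕 g ξ = (m ((2 * Real.pi) • ξ) : ℂ) * 𝓕 f ξ)
    (hm : ∀ ξ, psi χ Θ n σ ξ * m ξ = psi χ Θ n σ ξ) :
    comp χ Θ n σ f = convS (ker (psiS χ Θ n σ)) g := by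
  apply eq_of_fourier_eq
  intro ξ
  rw [fourier_comp, fourier_convS_ker, psiS_apply, hg, ← mul_assoc, ← Complex.ofReal_mul, hm]

lemma leafNorm_comp_succ_le {χ : Cutoff} {Θ Θ' : ConeSystem d ds du} (h : Θ.Below Θ') {n : ℕ}
    {σ : Sgn} {f g : Sch d} (hg : comp χ Θ (n + 1) σ f = convS (ker (psiS χ Θ (n + 1) σ)) g) :
    leafNorm Θ (comp χ Θ (n + 1) σ f) ≤
      (∫⁻ z, ‖ker (psiS χ Θ 1 σ) z‖ₑ) * leafNorm Θ' g := by
  rw [hg]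
  refine (Θ.leafNorm_convS_le _ _).trans ?_
  rw [psiS_succ, lintegral_ker_dilate]
  gcongr
  exact h.leafNorm_le g

lemma rpow_neg_mul_le {r B : ℝ} (hB : 0 ≤ B) {n k : ℕ} (h1 : k ≤ n + 1) (h2 : n ≤ k + 1) :
    (2 : ℝ) ^ (-(r * k)) * B ≤ 2 ^ |r| * 2 ^ (-(r * n)) * B := by
  rw [← Real.rpow_add (by norm_num)]
  gcongr
  · norm_num
  · have h1' : (k : ℝ) ≤ n + 1 := by exact_mod_cast h1
    have h2' : (n : ℝ) ≤ k + 1 := by exact_mod_cast h2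
    have : r * (n - k) ≤ |r| := by
      refine (le_abs_self _).trans ?_
      rw [abs_mul]
      exact mul_le_of_le_one_right (abs_nonneg _) (abs_le.2 ⟨by linarith, by linarith⟩)
    linarith

/-- The `+` components for `Θ` inherit the decay `2^{-tn}` of the `+` components for `Θ'`; the `-`
components for `Θ'`, whose decay is weaker, do not enter. -/
lemma exists_leafNorm_comp_plus_le (χ : Cutoff) {Θ Θ' : ConeSystem d ds du} (h : Θ.Below Θ')
    (t s : ℝ) :
    ∃ C : ℝ, 0 ≤ C ∧ ∀ (n : ℕ) (f : Sch d) (B : ℝ), 0 ≤ B →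
      localNorm χ Θ' t s f ≤ ENNReal.ofReal B →
      leafNorm Θ (comp χ Θ (n + 2) .plus f) ≤
        ENNReal.ofReal (C * 2 ^ (-(t * (n + 2 : ℕ))) * B) := by
  obtain ⟨K, hK⟩ : ∃ K : ℝ≥0, (K : ℝ≥0∞) = ∫⁻ z, ‖ker (psiS χ Θ 1 .plus) z‖ₑ :=
    ⟨_, ENNReal.coe_toNNReal (lintegral_enorm_lt_top _).ne⟩
  refine ⟨K * (3 * 2 ^ |t|), by positivity, fun n f B hB hf => ?_⟩
  have hleaf : ∀ k : ℕ, k ≤ (n + 2) + 1 → n + 2 ≤ k + 1 → leafNorm Θ' (comp χ Θ' k .plus f) ≤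
      ENNReal.ofReal (2 ^ |t| * 2 ^ (-(t * (n + 2 : ℕ))) * B) := fun k h1 h2 =>
    (leafNorm_comp_le_of_signedNorm_le ((le_max_left _ _).trans hf) k).trans
      (ENNReal.ofReal_le_ofReal (rpow_neg_mul_le hB h1 h2))
  have hg := comp_eq_convS_of_mul_eq (χ := χ) (Θ := Θ) (n := n + 2) (σ := .plus) (f := f)
    (g := comp χ Θ' (n + 1) .plus f + comp χ Θ' (n + 2) .plus f + comp χ Θ' (n + 3) .plus f)
    (m := fun ξ => psi χ Θ' (n + 1) .plus ξ + psi χ Θ' (n + 2) .plus ξ + psi χ Θ' (n + 3) .plus ξ)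
    (fun ξ => by
      simp only [FourierTransform.fourier_add, add_apply, fourier_comp]
      push_cast
      ring) (psi_plus_mul_neighbours χ h n)
  refine (leafNorm_comp_succ_le h hg).trans ?_
  rw [← hK]
  calc (K : ℝ≥0∞) * leafNorm Θ' (comp χ Θ' (n + 1) .plus f + comp χ Θ' (n + 2) .plus f +
        comp χ Θ' (n + 3) .plus f : Sch d)
      ≤ K * (ENNReal.ofReal (2 ^ |t| * 2 ^ (-(t * (n + 2 : ℕ))) * B) +
          ENNReal.ofReal (2 ^ |t| * 2 ^ (-(t * (n + 2 : ℕ))) * B) +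
          ENNReal.ofReal (2 ^ |t| * 2 ^ (-(t * (n + 2 : ℕ))) * B)) := by
        gcongr
        refine (leafNorm_add_le _ _ _).trans (add_le_add ((leafNorm_add_le _ _ _).trans
          (add_le_add ?_ ?_)) ?_)
        · exact hleaf _ (by omega) (by omega)
        · exact hleaf _ (by omega) (by omega)
        · exact hleaf _ (by omega) (by omega)
    _ = _ := by
        rw [← ENNReal.ofReal_add (by positivity) (by positivity),
          ← ENNReal.ofReal_add (by positivity) (by positivity), ← ENNReal.ofReal_coe_nnreal,
          ← ENNReal.ofReal_mul K.coe_nonneg]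
        congr 1
        ring

/-- The `-` components for `Θ` decay as `2^{-sn}`. Components of both signs for `Θ'` enter, and
those of sign `+` decay at least as fast because `s ≤ t`. -/
lemma exists_leafNorm_comp_minus_le (χ : Cutoff) {Θ Θ' : ConeSystem d ds du} (h : Θ.Below Θ')
    {t s : ℝ} (hst : s ≤ t) :
    ∃ C : ℝ, 0 ≤ C ∧ ∀ (n : ℕ) (f : Sch d) (B : ℝ), 0 ≤ B →
      localNorm χ Θ' t s f ≤ ENNReal.ofReal B →
      leafNorm Θ (comp χ Θ (n + 2) .minus f) ≤
        ENNReal.ofReal (C * 2 ^ (-(s * (n + 2 : ℕ))) * B) := by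
  obtain ⟨K, hK⟩ : ∃ K : ℝ≥0, (K : ℝ≥0∞) = ∫⁻ z, ‖ker (psiS χ Θ 1 .minus) z‖ₑ :=
    ⟨_, ENNReal.coe_toNNReal (lintegral_enorm_lt_top _).ne⟩
  refine ⟨K * (6 * 2 ^ |s|), by positivity, fun n f B hB hf => ?_⟩
  have hleaf : ∀ k : ℕ, k ≤ (n + 2) + 1 → n + 2 ≤ k + 1 →
      leafNorm Θ' (comp χ Θ' k .plus f + comp χ Θ' k .minus f : Sch d) ≤
      ENNReal.ofReal (2 * (2 ^ |s| * 2 ^ (-(s * (n + 2 : ℕ))) * B)) := by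
    intro k h1 h2
    have h3 := rpow_neg_mul_le (r := s) hB h1 h2
    have hp : leafNorm Θ' (comp χ Θ' k .plus f) ≤
        ENNReal.ofReal (2 ^ |s| * 2 ^ (-(s * (n + 2 : ℕ))) * B) := by
      refine (leafNorm_comp_le_of_signedNorm_le ((le_max_left _ _).trans hf) k).trans
        (ENNReal.ofReal_le_ofReal (le_trans ?_ h3))
      gcongr
      norm_num
    have hm : leafNorm Θ' (comp χ Θ' k .minus f) ≤
        ENNReal.ofReal (2 ^ |s| * 2 ^ (-(s * (n + 2 : ℕ))) * B) :=
      (leafNorm_comp_le_of_signedNorm_le ((le_max_right _ _).trans hf) k).trans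
        (ENNReal.ofReal_le_ofReal h3)
    refine (leafNorm_add_le _ _ _).trans ((add_le_add hp hm).trans (le_of_eq ?_))
    rw [← ENNReal.ofReal_add (by positivity) (by positivity), two_mul]
  have hg := comp_eq_convS_of_mul_eq (χ := χ) (Θ := Θ) (n := n + 2) (σ := .minus) (f := f)
    (g := (comp χ Θ' (n + 1) .plus f + comp χ Θ' (n + 1) .minus f) +
      (comp χ Θ' (n + 2) .plus f + comp χ Θ' (n + 2) .minus f) +
      (comp χ Θ' (n + 3) .plus f + comp χ Θ' (n + 3) .minus f))
    (m := fun ξ => (psi χ Θ' (n + 1) .plus ξ + psi χ Θ' (n + 1) .minus ξ) +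
      (psi χ Θ' (n + 2) .plus ξ + psi χ Θ' (n + 2) .minus ξ) +
      (psi χ Θ' (n + 3) .plus ξ + psi χ Θ' (n + 3) .minus ξ))
    (fun ξ => by
      simp only [FourierTransform.fourier_add, add_apply, fourier_comp]
      push_cast
      ring) (psi_minus_mul_neighbours χ Θ Θ' n)
  refine (leafNorm_comp_succ_le h hg).trans ?_
  rw [← hK]
  set a : ℕ → Sch d := fun k => comp χ Θ' k .plus f + comp χ Θ' k .minus f
  calc (K : ℝ≥0∞) * leafNorm Θ' (a (n + 1) + a (n + 2) + a (n + 3) : Sch d)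
      ≤ K * (ENNReal.ofReal (2 * (2 ^ |s| * 2 ^ (-(s * (n + 2 : ℕ))) * B)) +
          ENNReal.ofReal (2 * (2 ^ |s| * 2 ^ (-(s * (n + 2 : ℕ))) * B)) +
          ENNReal.ofReal (2 * (2 ^ |s| * 2 ^ (-(s * (n + 2 : ℕ))) * B))) := by
        gcongr
        refine (leafNorm_add_le _ _ _).trans (add_le_add ((leafNorm_add_le _ _ _).trans
          (add_le_add ?_ ?_)) ?_)
        · exact hleaf _ (by omega) (by omega)
        · exact hleaf _ (by omega) (by omega)
        · exact hleaf _ (by omega) (by omega)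
    _ = _ := by
        rw [← ENNReal.ofReal_add (by positivity) (by positivity),
          ← ENNReal.ofReal_add (by positivity) (by positivity), ← ENNReal.ofReal_coe_nnreal,
          ← ENNReal.ofReal_mul K.coe_nonneg]
        congr 1
        ring

open Classical in
/-- If the components of index at least `2` decay as `2^{-r'n}` and `r < r'`, then all but finitely
many of them contribute at most `ε B` to the norm of order `r`; the others are smoothing operators,
to which `exists_leafNorm_convS_le_finset` applies. -/
lemma exists_signedNorm_le_finset (χ : Cutoff) (Θ Θ' : ConeSystem d ds du) (σ : Sgn)
    {t' s' r r' : ℝ} (hr : r < r') {R : ℝ} (hR : 0 < R) {C₀ : ℝ}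
    (hhigh : ∀ (n : ℕ) (f : Sch d) (B : ℝ), 0 ≤ B → localNorm χ Θ' t' s' f ≤ ENNReal.ofReal B →
      leafNorm Θ (comp χ Θ (n + 2) σ f) ≤ ENNReal.ofReal (C₀ * 2 ^ (-(r' * (n + 2 : ℕ))) * B))
    {ε : ℝ} (hε : 0 < ε) :
    ∃ (J : Finset (Sch d × Eu d)) (C : ℝ), 0 ≤ C ∧ ∀ f : Sch d, (∀ y, R ≤ ‖y‖ → f y = 0) →
      ∀ B : ℝ, 0 ≤ B → localNorm χ Θ' t' s' f ≤ ENNReal.ofReal B →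
      signedNorm χ Θ r σ f ≤ ENNReal.ofReal (ε * B + C * ∑ p ∈ J, ‖convS p.1 f p.2‖) := by
  choose X C hC h using fun n : ℕ => exists_leafNorm_convS_le_finset χ Θ' Θ t' s' hR
    (ker (psiS χ Θ n σ)) (ε := ε * (2 ^ (r * n))⁻¹) (by positivity)
  obtain ⟨n₀, hn₀⟩ : ∃ n₀ : ℕ, ∀ n ≥ n₀, C₀ * (2 ^ (r - r') : ℝ) ^ n < ε := by
    have h1 : Filter.Tendsto (fun n : ℕ => C₀ * (2 ^ (r - r') : ℝ) ^ n) Filter.atTop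
        (nhds (C₀ * 0)) :=
      (tendsto_pow_atTop_nhds_zero_of_lt_one (by positivity)
        (Real.rpow_lt_one_of_one_lt_of_neg (by norm_num) (by linarith))).const_mul C₀
    rw [mul_zero] at h1
    exact Filter.eventually_atTop.1 (h1.eventually_lt_const hε)
  set D := ∑ n ∈ Finset.range (n₀ + 2), 2 ^ (r * n) * C n with hD
  have hD0 : 0 ≤ D := Finset.sum_nonneg fun n _ => mul_nonneg (by positivity) (hC n)
  refine ⟨(Finset.range (n₀ + 2)).biUnion fun n => {ker (psiS χ Θ n σ)} ×ˢ X n, D, hD0,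
    fun f hf B hB hfB => iSup_le fun n => ?_⟩
  rw [component_eq]
  set S := ∑ p ∈ (Finset.range (n₀ + 2)).biUnion fun n => {ker (psiS χ Θ n σ)} ×ˢ X n,
    ‖convS p.1 f p.2‖ with hS
  have hS0 : 0 ≤ S := Finset.sum_nonneg fun _ _ => norm_nonneg _
  by_cases hn : n < n₀ + 2
  · have h2 : ∑ x ∈ X n, ‖convS (ker (psiS χ Θ n σ)) f x‖ ≤ S := by
      have h3 : ∑ p ∈ ({ker (psiS χ Θ n σ)} : Finset (Sch d)) ×ˢ X n, ‖convS p.1 f p.2‖ =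
          ∑ x ∈ X n, ‖convS (ker (psiS χ Θ n σ)) f x‖ := by
        rw [Finset.sum_product, Finset.sum_singleton]
      rw [← h3]
      exact Finset.sum_le_sum_of_subset_of_nonneg
        (Finset.subset_biUnion_of_mem (fun n => ({ker (psiS χ Θ n σ)} : Finset (Sch d)) ×ˢ X n)
          (Finset.mem_range.2 hn)) fun _ _ _ => norm_nonneg _
    have h4 : 2 ^ (r * n) * C n ≤ D :=
      Finset.single_le_sum (f := fun n : ℕ => (2 : ℝ) ^ (r * n) * C n)
        (fun n _ => mul_nonneg (by positivity) (hC n)) (Finset.mem_range.2 hn)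
    have h5 := hC n
    calc ENNReal.ofReal (2 ^ (r * n)) * leafNorm Θ (comp χ Θ n σ f)
        ≤ ENNReal.ofReal (2 ^ (r * n)) * ENNReal.ofReal (ε * (2 ^ (r * n))⁻¹ * B +
            C n * ∑ x ∈ X n, ‖convS (ker (psiS χ Θ n σ)) f x‖) := by
          gcongr
          exact h n f hf B hB hfB
      _ = ENNReal.ofReal (ε * B + 2 ^ (r * n) * C n *
            ∑ x ∈ X n, ‖convS (ker (psiS χ Θ n σ)) f x‖) := by
          rw [← ENNReal.ofReal_mul (by positivity)]
          congr 1
          field_simp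
      _ ≤ _ := by gcongr
  · obtain ⟨m, rfl⟩ : ∃ m, n = m + 2 := ⟨n - 2, by omega⟩
    calc ENNReal.ofReal (2 ^ (r * (m + 2 : ℕ))) * leafNorm Θ (comp χ Θ (m + 2) σ f)
        ≤ ENNReal.ofReal (2 ^ (r * (m + 2 : ℕ))) *
            ENNReal.ofReal (C₀ * 2 ^ (-(r' * (m + 2 : ℕ))) * B) := by
          gcongr
          exact hhigh m f B hB hfB
      _ = ENNReal.ofReal (C₀ * (2 ^ (r - r') : ℝ) ^ (m + 2) * B) := by
          rw [← ENNReal.ofReal_mul (by positivity), ← Real.rpow_natCast,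
            ← Real.rpow_mul (by norm_num), sub_mul, sub_eq_add_neg, Real.rpow_add (by norm_num)]
          congr 1
          ring
      _ ≤ _ := by
          refine ENNReal.ofReal_le_ofReal ?_
          have h6 := (hn₀ (m + 2) (by omega)).le
          have h7 : C₀ * (2 ^ (r - r') : ℝ) ^ (m + 2) * B ≤ ε * B := by gcongr
          have : 0 ≤ D * S := by positivity
          linarith

open Classical in
/-- The comparison behind the compact embedding: up to an arbitrarily small multiple of the
stronger norm, the weaker norm is controlled by finitely many linear functionals. -/
lemma exists_localNorm_le_finset (χ : Cutoff) {Θ Θ' : ConeSystem d ds du} (h : Θ.Below Θ')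
    {t s t' s' : ℝ} (ht : t < t') (hs : s < s') (hst : s' ≤ t') {R : ℝ} (hR : 0 < R)
    {ε : ℝ} (hε : 0 < ε) :
    ∃ (J : Finset (Sch d × Eu d)) (C : ℝ), 0 ≤ C ∧ ∀ f : Sch d, (∀ y, R ≤ ‖y‖ → f y = 0) →
      ∀ B : ℝ, 0 ≤ B → localNorm χ Θ' t' s' f ≤ ENNReal.ofReal B →
      localNorm χ Θ t s f ≤ ENNReal.ofReal (ε * B + C * ∑ p ∈ J, ‖convS p.1 f p.2‖) := by
  obtain ⟨A₁, -, h₁⟩ := exists_leafNorm_comp_plus_le χ h t' s'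
  obtain ⟨A₂, -, h₂⟩ := exists_leafNorm_comp_minus_le χ h hst
  obtain ⟨J₁, C₁, hC₁, h₃⟩ := exists_signedNorm_le_finset χ Θ Θ' .plus ht hR h₁ hε
  obtain ⟨J₂, C₂, hC₂, h₄⟩ := exists_signedNorm_le_finset χ Θ Θ' .minus hs hR h₂ hε
  refine ⟨J₁ ∪ J₂, C₁ + C₂, by positivity, fun f hf B hB hfB => max_le ?_ ?_⟩
  · refine (h₃ f hf B hB hfB).trans (ENNReal.ofReal_le_ofReal ?_)
    gcongr
    · linarith
    · exact Finset.subset_union_left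
  · refine (h₄ f hf B hB hfB).trans (ENNReal.ofReal_le_ofReal ?_)
    gcongr
    · linarith
    · exact Finset.subset_union_right

end Comparison

/-! ### Operators between completions -/

section Abstract

open UniformSpace

/-- An operator that is controlled, up to an arbitrarily small multiple of the norm, by finitely
many continuous functionals is compact. -/
lemma isCompactOperator_of_forall_exists_functionals.{w} {X Y : Type*} [NormedAddCommGroup X]
    [NormedSpace ℂ X] [NormedAddCommGroup Y] [NormedSpace ℂ Y] [CompleteSpace Y] (T : X →L[ℂ] Y)
    (h : ∀ ε : ℝ, 0 < ε → ∃ (J : Type w) (_ : Fintype J) (ℓ : J → X →L[ℂ] ℂ),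
      ∀ x, ‖T x‖ ≤ ε * ‖x‖ + ∑ j, ‖ℓ j x‖) : IsCompactOperator T := by
  refine (isCompactOperator_iff_isCompact_closure_image_closedBall T.toLinearMap
    (r := 1) one_pos).2 ?_
  refine (TotallyBounded.closure ?_).isCompact_of_isClosed isClosed_closure
  refine Metric.totallyBounded_iff.2 fun ε hε => ?_
  obtain ⟨J, hJ, ℓ, hℓ⟩ := h (ε / 4) (by positivity)
  let Λ : X →L[ℂ] (J → ℂ) := ContinuousLinearMap.pi ℓ
  have hΛ : TotallyBounded (Λ '' Metric.closedBall 0 1) :=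
    (Λ.lipschitz.isBounded_image Metric.isBounded_closedBall).isCompact_closure.totallyBounded
      |>.subset subset_closure
  set δ := ε / (4 * (Fintype.card J + 1)) with hδ
  have hδ0 : 0 < δ := by positivity
  obtain ⟨t, htΛ, htf, ht⟩ := hΛ.exists_subset (Metric.dist_mem_uniformity hδ0)
  choose! g hg using fun v (hv : v ∈ t) => htΛ hv
  refine ⟨(fun v => T (g v)) '' t, htf.image _, ?_⟩
  rintro _ ⟨x, hx, rfl⟩
  have hx' := ht ⟨x, hx, rfl⟩
  simp only [mem_iUnion, mem_ofPred_eq, exists_prop] at hx' ⊢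
  obtain ⟨v, hv, hxv⟩ := hx'
  refine ⟨_, ⟨v, hv, rfl⟩, ?_⟩
  rw [Metric.mem_ball, dist_eq_norm]
  change ‖T x - T (g v)‖ < ε
  rw [← map_sub]
  have h1 : ‖x - g v‖ ≤ 2 := by
    have h2 : ‖x‖ ≤ 1 := by simpa using hx
    have h3 : ‖g v‖ ≤ 1 := by simpa using (hg v hv).1
    linarith [norm_sub_le x (g v)]
  have h4 : ∀ j, ‖ℓ j (x - g v)‖ ≤ δ := by
    intro j
    have h5 : dist (Λ x j) (Λ (g v) j) ≤ dist (Λ x) (Λ (g v)) := dist_le_pi_dist _ _ j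
    rw [map_sub, ← dist_eq_norm]
    refine le_trans h5 ?_
    rw [(hg v hv).2]
    exact le_of_lt hxv
  have h6 : ∑ j, ‖ℓ j (x - g v)‖ ≤ Fintype.card J * δ := by
    refine (Finset.sum_le_card_nsmul _ _ _ fun j _ => h4 j).trans (le_of_eq ?_)
    rw [nsmul_eq_mul, Finset.card_univ]
  have h7 : (Fintype.card J + 1) * δ = ε / 4 := by
    rw [hδ]; field_simp
  have h8 : ε / 4 * ‖x - g v‖ ≤ ε / 4 * 2 := by gcongr
  linarith [hℓ (x - g v)]

/-- The same criterion for the extension of an operator to the completions; the estimate is only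
needed on the dense subspace. -/
lemma isCompactOperator_completion.{w} {X Y : Type*} [SeminormedAddCommGroup X]
    [NormedSpace ℂ X] [SeminormedAddCommGroup Y] [NormedSpace ℂ Y] (T : X →L[ℂ] Y)
    (h : ∀ ε : ℝ, 0 < ε → ∃ (J : Type w) (_ : Fintype J) (ℓ : J → X →L[ℂ] ℂ),
      ∀ x, ‖T x‖ ≤ ε * ‖x‖ + ∑ j, ‖ℓ j x‖) : IsCompactOperator T.completion := by
  refine isCompactOperator_of_forall_exists_functionals.{w} _ fun ε hε => ?_
  obtain ⟨J, hJ, ℓ, hℓ⟩ := h ε hε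
  refine ⟨J, hJ, fun j => (ℓ j).fromCompletion, fun x => ?_⟩
  induction x using Completion.induction_on with
  | hp => exact isClosed_le (by fun_prop) (by fun_prop)
  | ih x =>
    rw [ContinuousLinearMap.completion_apply_coe, Completion.norm_coe, Completion.norm_coe]
    simpa using hℓ x

/-- Suppose that the norm of `X` is the supremum of a family of seminorms `q a`, each of which is
bounded by a multiple of `‖T ·‖`. Then the extension of `T` to the completions is
injective. -/
lemma injective_completion {X Y A : Type*} [SeminormedAddCommGroup X]
    [NormedSpace ℂ X] [SeminormedAddCommGroup Y] [NormedSpace ℂ Y] (T : X →L[ℂ] Y)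
    (q : A → X → ℝ≥0∞)
    (hq : ∀ x, ∀ c : ℝ, 0 ≤ c → (∀ a, q a x ≤ ENNReal.ofReal c) → ‖x‖ ≤ c)
    (hle : ∀ a x, q a x ≤ ENNReal.ofReal ‖x‖)
    (hadd : ∀ a x y, q a x ≤ q a (x - y) + q a y)
    (hT : ∀ a, ∃ C : ℝ, 0 ≤ C ∧ ∀ x, q a x ≤ ENNReal.ofReal (C * ‖T x‖)) :
    Function.Injective T.completion := by
  refine (injective_iff_map_eq_zero _).2 fun x hx => ?_
  have happ : ∀ δ : ℝ, 0 < δ → ∃ φ : X, ‖x - (φ : Completion X)‖ < δ := by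
    intro δ hδ
    obtain ⟨φ, hφ⟩ := Metric.denseRange_iff.1 (Completion.denseRange_coe (α := X)) x δ hδ
    exact ⟨φ, by rwa [dist_eq_norm] at hφ⟩
  rw [← norm_le_zero_iff]
  refine le_of_forall_pos_le_add fun ε hε => ?_
  obtain ⟨φ, hφ⟩ := happ (ε / 4) (by positivity)
  -- A second, `a`-dependent approximation `ψ` of `x` makes `q a ψ` small, while `q a (φ - ψ)` is
  -- bounded uniformly in `a`.
  have h1 : ‖φ‖ ≤ 3 * (ε / 4) := by
    refine hq φ _ (by positivity) fun a => ?_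
    obtain ⟨C, hC, hTa⟩ := hT a
    set K := ‖T.completion‖
    obtain ⟨ψ, hψ⟩ := happ (ε / (4 * (C * K + 1))) (by positivity)
    have h2 : ‖φ - ψ‖ ≤ 2 * (ε / 4) := by
      have h3 : ε / (4 * (C * K + 1)) ≤ ε / 4 := by
        gcongr
        have : 0 ≤ C * K := by positivity
        linarith
      rw [← Completion.norm_coe, Completion.coe_sub]
      have h4 := norm_sub_le (x - (ψ : Completion X)) (x - (φ : Completion X))
      rw [sub_sub_sub_cancel_left] at h4
      linarith
    have h5 : C * ‖T ψ‖ ≤ ε / 4 := by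
      have h6 : ‖T ψ‖ ≤ K * ‖x - (ψ : Completion X)‖ := by
        have h7 := T.completion.le_opNorm (x - (ψ : Completion X))
        rwa [map_sub, hx, zero_sub, norm_neg, ContinuousLinearMap.completion_apply_coe,
          Completion.norm_coe] at h7
      calc C * ‖T ψ‖ ≤ C * (K * ‖x - (ψ : Completion X)‖) := by gcongr
        _ ≤ C * (K * (ε / (4 * (C * K + 1)))) := by gcongr
        _ = C * K / (C * K + 1) * (ε / 4) := by field_simp
        _ ≤ 1 * (ε / 4) := by
          gcongr
          rw [div_le_one (by positivity)]
          linarith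
        _ = ε / 4 := one_mul _
    calc q a φ ≤ q a (φ - ψ) + q a ψ := hadd a φ ψ
      _ ≤ ENNReal.ofReal (2 * (ε / 4)) + ENNReal.ofReal (ε / 4) := by
        gcongr
        · exact (hle a _).trans (ENNReal.ofReal_le_ofReal h2)
        · exact (hTa ψ).trans (ENNReal.ofReal_le_ofReal h5)
      _ = _ := by
        rw [← ENNReal.ofReal_add (by positivity) (by positivity)]
        congr 1
        ring
  have h2 := norm_le_norm_add_norm_sub (φ : Completion X) x
  rw [Completion.norm_coe, norm_sub_rev] at h2
  linarith

end Abstract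

/-! ### Localisation in charts -/

section Charts

universe w

variable {d ds du : ℕ} {M : Type*} [TopologicalSpace M] [ChartedSpace (Eu d) M]
  {V : Set M} {I : Type w} [Fintype I]

/-- The localised functions have their supports in a common ball. -/
lemma ChartSystem.exists_push_eq_zero (D : ChartSystem (d := d) V I) (i : I) :
    ∃ R : ℝ, 0 < R ∧ ∀ (φ : M → ℂ) (y : Eu d), R ≤ ‖y‖ → D.push i φ y = 0 := by
  have hK : IsCompact ((D.chart i) '' tsupport (D.θ i)) :=
    (D.θ_compact i).image_of_continuousOn
      ((D.chart i).continuousOn.mono (D.θ_support i))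
  obtain ⟨R, hR, h⟩ := hK.isBounded.exists_pos_norm_lt
  refine ⟨R, hR, fun φ y hy => ?_⟩
  by_cases hyt : y ∈ (D.chart i).target
  · rw [ChartSystem.push, indicator_of_mem hyt, image_eq_zero_of_notMem_tsupport (f := D.θ i)]
    · simp
    · exact fun h' => (h y ⟨_, h', (D.chart i).right_inv hyt⟩).not_ge hy
  · exact indicator_of_notMem hyt _

lemma ChartSystem.contDiff_push (D : ChartSystem (d := d) V I) (i : I) {φ : M → ℂ}
    (hφ : ContMDiff (𝓡 d) 𝓘(ℝ, ℂ) ∞ φ) : ContDiff ℝ ∞ (D.push i φ) := by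
  have hK : IsCompact ((D.chart i) '' tsupport (D.θ i)) :=
    (D.θ_compact i).image_of_continuousOn
      ((D.chart i).continuousOn.mono (D.θ_support i))
  have hsymm := contMDiffOn_symm_of_mem_maximalAtlas (D.chart_mem i)
  have hgs : ContDiffOn ℝ ∞ (fun x => ((D.θ i ((D.chart i).symm x) : ℝ) : ℂ) *
      φ ((D.chart i).symm x)) (D.chart i).target :=
    (Complex.ofRealCLM.contDiff.comp_contDiffOn
      ((D.θ_smooth i).comp_contMDiffOn hsymm).contDiffOn).mul (hφ.comp_contMDiffOn hsymm).contDiffOn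
  rw [contDiff_iff_contDiffAt]
  intro x
  by_cases hx : x ∈ (D.chart i).target
  · have hn : (D.chart i).target ∈ nhds x := (D.chart i).open_target.mem_nhds hx
    refine (hgs.contDiffAt hn).congr_of_eventuallyEq ?_
    filter_upwards [hn] with y hy
    rw [ChartSystem.push, indicator_of_mem hy]
  · have hx' : x ∉ (D.chart i) '' tsupport (D.θ i) := by
      rintro ⟨y, hy, rfl⟩
      exact hx ((D.chart i).map_source (D.θ_support i hy))
    refine (contDiffAt_const (c := (0 : ℂ))).congr_of_eventuallyEq ?_
    filter_upwards [hK.isClosed.isOpen_compl.mem_nhds hx'] with y hy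
    by_cases hyt : y ∈ (D.chart i).target
    · rw [ChartSystem.push, indicator_of_mem hyt, image_eq_zero_of_notMem_tsupport (f := D.θ i)]
      · simp
      · exact fun h' => hy ⟨_, h', (D.chart i).right_inv hyt⟩
    · exact indicator_of_notMem hyt _

/-- The localisation `(θ_i φ) ∘ κ_i⁻¹` of a smooth function, as a linear map to Schwartz
functions. -/
def ChartSystem.pushS (D : ChartSystem (d := d) V I) (i : I) : SmoothOn d V →ₗ[ℂ] Sch d where
  toFun φ := HasCompactSupport.toSchwartzMap (f := D.push i φ.1)
    (D.push_continuous i φ.2.1.continuous).2 (D.contDiff_push i φ.2.1)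
  map_add' φ ψ := by
    ext x
    change D.push i (φ.1 + ψ.1) x = D.push i φ.1 x + D.push i ψ.1 x
    by_cases hx : x ∈ (D.chart i).target
    · simp only [ChartSystem.push, Pi.add_apply, indicator_of_mem hx]
      ring
    · simp only [ChartSystem.push, indicator_of_notMem hx, add_zero]
  map_smul' c φ := by
    ext x
    change D.push i (c • φ.1) x = c * D.push i φ.1 x
    by_cases hx : x ∈ (D.chart i).target
    · simp only [ChartSystem.push, Pi.smul_apply, indicator_of_mem hx, smul_eq_mul]
      ring
    · simp only [ChartSystem.push, indicator_of_notMem hx, mul_zero]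

lemma ChartSystem.mem_finite (D : ChartSystem (d := d) V I) (χ : Cutoff)
    (Θ : I → ConeSystem d ds du) (t s : ℝ) {φ : M → ℂ} (hφ : φ ∈ SmoothOn d V) :
    φ ∈ D.finite χ Θ t s := by
  refine ⟨hφ, ?_⟩
  have h : ∀ i, localNorm χ (Θ i) t s (D.push i φ) < ⊤ := fun i =>
    localNorm_lt_top χ (Θ i) t s (D.pushS i ⟨φ, hφ⟩)
  refine lt_of_le_of_lt (b := ∑ i, localNorm χ (Θ i) t s (D.push i φ)) (iSup_le fun i => ?_)
    (ENNReal.sum_lt_top.2 fun i _ => h i)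
  exact Finset.single_le_sum (f := fun i => localNorm χ (Θ i) t s (D.push i φ))
    (fun _ _ => zero_le) (Finset.mem_univ i)

variable (D : ChartSystem (d := d) V I) (χ : Cutoff) (Θ Θ' : I → ConeSystem d ds du)
  (t s t' s' : ℝ)

/-- The inclusion of the normed space `C^∞(V̄)` into the smooth functions. -/
def PreB.toSmooth : PreB D χ Θ t s →ₗ[ℂ] SmoothOn d V where
  toFun φ := ⟨φ.1, φ.2.1⟩
  map_add' _ _ := rfl
  map_smul' _ _ := rfl

lemma PreB.toSmooth_apply (φ : PreB D χ Θ t s) :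
    PreB.toSmooth D χ Θ t s φ = ⟨φ.1, φ.2.1⟩ := rfl

lemma PreB.coe_toSmooth (φ : PreB D χ Θ t s) : (PreB.toSmooth D χ Θ t s φ).1 = φ.1 :=
  (congrArg Subtype.val (PreB.toSmooth_apply D χ Θ t s φ)).trans (Subtype.coe_mk _ _)

lemma PreB.norm_def (φ : PreB D χ Θ t s) : ‖φ‖ = (D.normB χ Θ t s φ.1).toReal := rfl

lemma PreB.localNorm_le (φ : PreB D χ Θ t s) (i : I) :
    localNorm χ (Θ i) t s (D.pushS i (PreB.toSmooth D χ Θ t s φ)) ≤ ENNReal.ofReal ‖φ‖ := by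
  rw [PreB.norm_def, ENNReal.ofReal_toReal φ.2.2.ne]
  exact le_iSup (fun i => localNorm χ (Θ i) t s (D.push i φ.1)) i

lemma PreB.norm_le {φ : PreB D χ Θ t s} {c : ℝ} (hc : 0 ≤ c)
    (h : ∀ i, localNorm χ (Θ i) t s (D.pushS i (PreB.toSmooth D χ Θ t s φ)) ≤
      ENNReal.ofReal c) : ‖φ‖ ≤ c := by
  rw [PreB.norm_def]
  exact ENNReal.toReal_le_of_le_ofReal hc (iSup_le h)

/-- The continuous linear functional `φ ↦ c (k * (θ_i φ) ∘ κ_i⁻¹)(x)`. -/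
lemma PreB.exists_functional (i : I) (k : Sch d) (x : Eu d) (c : ℝ) :
    ∃ ℓ : PreB D χ Θ t s →L[ℂ] ℂ, ∀ φ,
      ℓ φ = c * convS k (D.pushS i (PreB.toSmooth D χ Θ t s φ)) x := by
  obtain ⟨R, hR, hz⟩ := D.exists_push_eq_zero i
  obtain ⟨C, hC, h⟩ := exists_norm_convS_le_of_localNorm_le χ (Θ i) t s hR k 0
  let L : PreB D χ Θ t s →ₗ[ℂ] ℂ :=
    { toFun := fun φ => c * convS k (D.pushS i (PreB.toSmooth D χ Θ t s φ)) x
      map_add' := fun φ ψ => by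
        rw [map_add, map_add, convS, map_add, add_apply, mul_add]
        rfl
      map_smul' := fun a φ => by
        rw [map_smul, map_smul, convS, map_smul, smul_apply, smul_eq_mul, RingHom.id_apply,
          smul_eq_mul]
        rw [mul_left_comm]
        rfl }
  refine ⟨L.mkContinuous (|c| * C) fun φ => ?_, fun φ => rfl⟩
  have h1 := h (D.pushS i (PreB.toSmooth D χ Θ t s φ)) (fun y hy => hz _ y hy) ‖φ‖
    (norm_nonneg _) (PreB.localNorm_le D χ Θ t s φ i) x
  rw [pow_zero, inv_one, mul_one] at h1
  change ‖(c : ℂ) * convS k (D.pushS i (PreB.toSmooth D χ Θ t s φ)) x‖ ≤ _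
  rw [norm_mul, Complex.norm_real, Real.norm_eq_abs, mul_assoc]
  gcongr

variable {t s t' s'}

lemma PreB.toSmooth_eq {φ : PreB D χ Θ' t' s'} {ψ : PreB D χ Θ t s} (h : φ.1 = ψ.1) :
    PreB.toSmooth D χ Θ t s ψ = PreB.toSmooth D χ Θ' t' s' φ :=
  Subtype.ext ((PreB.coe_toSmooth D χ Θ t s ψ).trans
    (h.symm.trans (PreB.coe_toSmooth D χ Θ' t' s' φ).symm))

/-- Up to a small multiple of the stronger norm, the weaker norm is controlled by finitely many
continuous functionals. -/
lemma PreB.exists_functionals (hΘ : ∀ i, (Θ i).Below (Θ' i)) (ht : t < t') (hs : s < s')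
    (hst : s' ≤ t') {ε : ℝ} (hε : 0 < ε) :
    ∃ (J : Type w) (_ : Fintype J) (ℓ : J → PreB D χ Θ' t' s' →L[ℂ] ℂ),
      ∀ (φ : PreB D χ Θ' t' s') (ψ : PreB D χ Θ t s), φ.1 = ψ.1 →
        ‖ψ‖ ≤ ε * ‖φ‖ + ∑ j, ‖ℓ j φ‖ := by
  choose R hR hz using fun i => D.exists_push_eq_zero i
  choose J C hC h using fun i => exists_localNorm_le_finset χ (hΘ i) ht hs hst (hR i) hε
  choose ℓ hℓ using fun p : (Σ i, J i) =>
    PreB.exists_functional D χ Θ' t' s' p.1 p.2.1.1 p.2.1.2 (C p.1)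
  refine ⟨Σ i, J i, inferInstance, ℓ, fun φ ψ hφψ => ?_⟩
  have hsum : 0 ≤ ∑ j, ‖ℓ j φ‖ := Finset.sum_nonneg fun _ _ => norm_nonneg _
  refine PreB.norm_le D χ Θ t s (by positivity) fun i => ?_
  rw [PreB.toSmooth_eq D χ Θ Θ' hφψ]
  refine (h i (D.pushS i (PreB.toSmooth D χ Θ' t' s' φ)) (fun y hy => hz i _ y hy) ‖φ‖
    (norm_nonneg _) (PreB.localNorm_le D χ Θ' t' s' φ i)).trans (ENNReal.ofReal_le_ofReal ?_)
  gcongr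
  rw [Fintype.sum_sigma]
  refine le_trans (le_of_eq ?_) (Finset.single_le_sum
    (f := fun i => ∑ p : J i, ‖ℓ ⟨i, p⟩ φ‖)
    (fun i _ => Finset.sum_nonneg fun _ _ => norm_nonneg _) (Finset.mem_univ i))
  rw [Finset.mul_sum, ← Finset.sum_coe_sort (J i)]
  refine Finset.sum_congr rfl fun p _ => ?_
  rw [hℓ, norm_mul, Complex.norm_real, Real.norm_of_nonneg (hC i)]

/-- The identity of `C^∞(V̄)` as a linear map between two anisotropic norms. -/
def PreB.identity (t s t' s' : ℝ) : PreB D χ Θ' t' s' →ₗ[ℂ] PreB D χ Θ t s where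
  toFun φ := ⟨φ.1, D.mem_finite χ Θ t s φ.2.1⟩
  map_add' _ _ := rfl
  map_smul' _ _ := rfl

lemma PreB.identity_apply (φ : PreB D χ Θ' t' s') : PreB.identity D χ Θ Θ' t s t' s' φ =
    (⟨φ.1, D.mem_finite χ Θ t s φ.2.1⟩ : D.finite χ Θ t s) := rfl

-- The two sides live in different subtypes, so `rfl` would have to compare the two norms.
lemma PreB.coe_identity (φ : PreB D χ Θ' t' s') :
    (PreB.identity D χ Θ Θ' t s t' s' φ).1 = φ.1 :=
  (congrArg Subtype.val (PreB.identity_apply D χ Θ Θ' φ)).trans (Subtype.coe_mk _ _)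

/-- The identity of `C^∞(V̄)` is continuous from the stronger to the weaker anisotropic norm. -/
lemma PreB.exists_continuousLinearMap (hΘ : ∀ i, (Θ i).Below (Θ' i)) (ht : t < t') (hs : s < s')
    (hst : s' ≤ t') : ∃ T : PreB D χ Θ' t' s' →L[ℂ] PreB D χ Θ t s, ∀ φ, φ.1 = (T φ).1 := by
  obtain ⟨J, hJ, ℓ, hℓ⟩ := PreB.exists_functionals D χ Θ Θ' hΘ ht hs hst one_pos
  refine ⟨(PreB.identity D χ Θ Θ' t s t' s').mkContinuous (1 + ∑ j, ‖ℓ j‖) fun φ => ?_,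
    fun φ => (PreB.coe_identity D χ Θ Θ' φ).symm⟩
  refine (hℓ φ _ (PreB.coe_identity D χ Θ Θ' φ).symm).trans ?_
  rw [add_mul, Finset.sum_mul]
  gcongr with j
  exact (ℓ j).le_opNorm φ

/-- The regularity exponent that goes with a sign: `t` for `+` and `s` for `-`. -/
def Sgn.exponent (t s : ℝ) : Sgn → ℝ
  | .plus => t
  | .minus => s

/-- The weighted leaf norm of a component; the anisotropic norm is the supremum of these. -/
def PreB.componentNorm (Θ : I → ConeSystem d ds du) (t s : ℝ) (a : I × Sgn × ℕ)
    (φ : PreB D χ Θ t s) : ℝ≥0∞ :=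
  ENNReal.ofReal ((2 : ℝ) ^ (a.2.1.exponent t s * (a.2.2 : ℝ))) *
    leafNorm (Θ a.1) (comp χ (Θ a.1) a.2.2 a.2.1 (D.pushS a.1 (PreB.toSmooth D χ Θ t s φ)))

end Charts

/-! ### The norm as a supremum over components -/

section Components

universe w

variable {d ds du : ℕ} {M : Type*} [TopologicalSpace M] [ChartedSpace (Eu d) M]
  {V : Set M} {I : Type w} [Fintype I] (D : ChartSystem (d := d) V I) (χ : Cutoff)
  (Θ Θ' : I → ConeSystem d ds du) (t s t' s' : ℝ)

lemma PreB.norm_le_of_componentNorm_le {φ : PreB D χ Θ t s} {c : ℝ} (hc : 0 ≤ c)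
    (h : ∀ a, PreB.componentNorm D χ Θ t s a φ ≤ ENNReal.ofReal c) : ‖φ‖ ≤ c := by
  refine PreB.norm_le D χ Θ t s hc fun i =>
    max_le (iSup_le fun n => ?_) (iSup_le fun n => ?_)
  · rw [component_eq]
    exact h (i, .plus, n)
  · rw [component_eq]
    exact h (i, .minus, n)

lemma PreB.componentNorm_le (a : I × Sgn × ℕ) (φ : PreB D χ Θ t s) :
    PreB.componentNorm D χ Θ t s a φ ≤ ENNReal.ofReal ‖φ‖ := by
  refine le_trans ?_ (PreB.localNorm_le D χ Θ t s φ a.1)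
  obtain ⟨i, σ, n⟩ := a
  cases σ with
  | plus =>
    refine le_trans ?_ (le_max_left _ _)
    refine le_trans (le_of_eq ?_) (le_iSup _ n)
    rw [component_eq]
    rfl
  | minus =>
    refine le_trans ?_ (le_max_right _ _)
    refine le_trans (le_of_eq ?_) (le_iSup _ n)
    rw [component_eq]
    rfl

lemma PreB.componentNorm_le_add (a : I × Sgn × ℕ) (φ ψ : PreB D χ Θ t s) :
    PreB.componentNorm D χ Θ t s a φ ≤
      PreB.componentNorm D χ Θ t s a (φ - ψ) + PreB.componentNorm D χ Θ t s a ψ := by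
  simp only [PreB.componentNorm]
  rw [← mul_add]
  gcongr
  refine le_trans (le_of_eq ?_) (leafNorm_add_le _ _ _)
  rw [comp, comp, comp, convS, convS, convS, ← map_add, ← map_add, ← map_add, sub_add_cancel]

/-- Each component is the image of a compactly supported function under a smoothing operator,
so any anisotropic norm controls it. -/
lemma PreB.exists_componentNorm_le (a : I × Sgn × ℕ) :
    ∃ C : ℝ, 0 ≤ C ∧ ∀ (φ : PreB D χ Θ' t' s') (ψ : PreB D χ Θ t s), φ.1 = ψ.1 →
      PreB.componentNorm D χ Θ' t' s' a φ ≤ ENNReal.ofReal (C * ‖ψ‖) := by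
  obtain ⟨R, hR, hz⟩ := D.exists_push_eq_zero a.1
  obtain ⟨C, hC, h⟩ := exists_leafNorm_convS_le χ (Θ a.1) (Θ' a.1) t s hR
    (ker (psiS χ (Θ' a.1) a.2.2 a.2.1))
  refine ⟨(2 : ℝ) ^ (a.2.1.exponent t' s' * (a.2.2 : ℝ)) * C, by positivity, fun φ ψ hφψ => ?_⟩
  have h1 := PreB.localNorm_le D χ Θ t s ψ a.1
  rw [PreB.toSmooth_eq D χ Θ Θ' hφψ] at h1
  rw [PreB.componentNorm, comp, mul_assoc, ENNReal.ofReal_mul (by positivity)]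
  refine mul_le_mul_right ?_ _
  exact h _ (fun y hy => hz _ y hy) _ (norm_nonneg _) h1

end Components

end Aniso

end

theorem theorem3 {d ds du : ℕ} {M : Type*} [TopologicalSpace M] [T2Space M]
    [ChartedSpace (EuclideanSpace ℝ (Fin d)) M] [IsManifold (𝓡 d) ∞ M]
    {V : Set M} (hV : IsOpen V) {I : Type*} [Fintype I]
    (D : Aniso.ChartSystem (d := d) V I) (χ : Aniso.Cutoff)
    (Θ Θ' : I → Aniso.ConeSystem d ds du) (hΘ : ∀ i, (Θ i).Below (Θ' i))
    {t s t' s' : ℝ} (hs : s < 0) (hs' : s' < 0) (ht : 0 < t) (ht' : 0 < t')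
    (htt' : t < t') (hss' : s < s') :
    (∀ φ ∈ Aniso.SmoothOn d V, φ ∈ D.finite χ Θ' t' s' ∧ φ ∈ D.finite χ Θ t s) ∧
    ∃ ι : Aniso.BSpace D χ Θ' t' s' →L[ℂ] Aniso.BSpace D χ Θ t s,
      (∀ (φ : M → ℂ) (hφ' : φ ∈ D.finite χ Θ' t' s') (hφ : φ ∈ D.finite χ Θ t s),
        ι (Aniso.toB D χ Θ' t' s' φ hφ') = Aniso.toB D χ Θ t s φ hφ) ∧
      Function.Injective ι ∧ IsCompactOperator ι := by
  refine ⟨fun φ hφ => ⟨D.mem_finite χ Θ' t' s' hφ, D.mem_finite χ Θ t s hφ⟩, ?_⟩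
  have hst : s' ≤ t' := (hs'.trans ht').le
  obtain ⟨T, hT⟩ := Aniso.PreB.exists_continuousLinearMap D χ Θ Θ' hΘ htt' hss' hst
  refine ⟨T.completion, fun φ hφ' hφ => ?_, ?_, ?_⟩
  · refine (T.completion_apply_coe _).trans (congrArg _ ?_)
    exact Subtype.ext ((hT (⟨φ, hφ'⟩ : D.finite χ Θ' t' s')).symm.trans
      ((Subtype.coe_mk φ hφ').trans (Subtype.coe_mk φ hφ).symm))
  · refine Aniso.injective_completion T (Aniso.PreB.componentNorm D χ Θ' t' s')
      (fun φ c hc h => Aniso.PreB.norm_le_of_componentNorm_le D χ Θ' t' s' hc h)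
      (Aniso.PreB.componentNorm_le D χ Θ' t' s') (Aniso.PreB.componentNorm_le_add D χ Θ' t' s')
      fun a => ?_
    obtain ⟨C, hC, h⟩ := Aniso.PreB.exists_componentNorm_le D χ Θ Θ' t s t' s' a
    exact ⟨C, hC, fun φ => h φ (T φ) (hT φ)⟩
  · refine Aniso.isCompactOperator_completion T fun ε hε => ?_
    obtain ⟨J, hJ, ℓ, hℓ⟩ := Aniso.PreB.exists_functionals D χ Θ Θ' hΘ htt' hss' hst hε
    exact ⟨J, hJ, ℓ, fun φ => hℓ φ (T φ) (hT φ)⟩
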